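/- Let $\mathrm{Cob}$ be the category whose objects are finite disjoint unions of circles and whose morphisms are the homeomorphism classes (relative to the boundary) of compact orientable two-dimensional cobordisms, i.e. a cobordism is given by its connected components, their genera and the distribution of the boundary circles among them; composition is gluing. For a commutative ring $k$ let $\mathrm{Cob}_{/l}(k)$ be the category with the same objects, whose morphisms are the $k$-linear combinations of cobordisms modulo the local relations * 4TU: $C_{12}+C_{34}=C_{13}+C_{24}$, where $C$ is a cobordism with four disjoint discs $D_1,\dots,D_4$ on it (on arbitrary components) and $C_{ij}$ is obtained from $C$ by replacing $D_i\cup D_j$ by a tube; * S: a cobordism with a closed component of genus $0$ is zero; * T: a closed component of genus $1$ may be dropped and replaced by the factor $2$. For an object $\mathcal O$ let $\mathcal F_{\mathcal O}=\operatorname{Mor}(\mathcal O,-)$ be the tautological functor on $\mathrm{Cob}_{/l}(k)$, which acts on morphisms by composition. For a commutative ring $R$ and $h,t\in R$ let $A_{h,t}=R[X]/(X^2-hX-t)$, with the Frobenius algebra structure over $R$ given by $\Delta(1)=1\otimes X+X\otimes 1-h\,1\otimes 1$, $\Delta(X)=X\otimes X+t\,1\otimes 1$, $\varepsilon(1)=0$,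 $\varepsilon(X)=1$. Let $\mathcal F_H$ be the two-dimensional TQFT (the functor from $\mathrm{Cob}$ to $R$-modules that maps disjoint unions to tensor products) given by the Frobenius algebra $A_{H,0}=R[X]/(X^2-HX)$ over $R=\mathbb Z[H]$, and let $\mathcal F_T$ be the one given by $A_{0,T}=R[X]/(X^2-T)$ over $R=\mathbb Q[T]$. (1) Let $k=\mathbb Z$ and let $\mathbb Z[H]$ act on $\operatorname{Mor}(\bigcirc,\mathcal O')$ by letting $H$ add a handle to the component that contains the source circle. Then $\mathcal F_\bigcirc$, regarded as a functor to $\mathbb Z[H]$-modules, is the TQFT $\mathcal F_H$: the composite of $\mathcal F_\bigcirc$ with the projection $\mathrm{Cob}\to\mathrm{Cob}_{/l}(\mathbb Z)$ is naturally isomorphic to $\mathcal F_H$. (2) Let $k=\mathbb Q$ and let $\mathbb Q[T]$ act on $\operatorname{Mor}(\emptyset,\mathcal O')$ by letting $T$ be the renormalized 2-handle operator, i.e. one quarter of the 2-handle operator, where the 2-handle operator is the disjoint union with $\tfrac12\Sigma_3$, and $\Sigma_3$ is the closed surface of genus $3$. Then $\mathcal F_\emptyset$, regarded as a functor to $\mathbb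 Q[T]$-modules, is the TQFT $\mathcal F_T$: the composite of $\mathcal F_\emptyset$ with the projection $\mathrm{Cob}\to\mathrm{Cob}_{/l}(\mathbb Q)$ is naturally isomorphic to $\mathcal F_T$. -/

import Mathlib

open CategoryTheory
open scoped TensorProduct

noncomputable section

/-! ### Compact orientable surfaces with labelled boundary circles -/

/-- A compact orientable surface whose boundary circles are labelled by `B`, presented by its
connected components (numbered by `Fin n`), the genus of every component, and the component on
which each boundary circle lies. Components without boundary circles are closed surfaces. -/
abbrev SurfaceData (B : Type) : Type := Σ n : ℕ, (Fin n → ℕ) × (B → Fin n)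

/-- Two presentations describe surfaces that are homeomorphic relative to the boundary iff they
differ by a renumbering of the components. -/
def surfaceSetoid (B : Type) : Setoid (SurfaceData B) where
  r x y := ∃ e : Fin x.1 ≃ Fin y.1,
    (∀ k, y.2.1 (e k) = x.2.1 k) ∧ (∀ b, y.2.2 b = e (x.2.2 b))
  iseqv :=
    { refl := fun _ => ⟨Equiv.refl _, fun _ => rfl, fun _ => rfl⟩
      symm := by
        rintro x y ⟨e, h1, h2⟩
        exact ⟨e.symm, fun k => by rw [← h1]; simp, fun b => by rw [h2]; simp⟩
      trans := by
        rintro x y z ⟨e, h1, h2⟩ ⟨f, h3, h4⟩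
        exact ⟨e.trans f, fun k => by simp [h3, h1], fun b => by simp [h4, h2]⟩ }

/-- Homeomorphism classes, relative to the boundary, of compact orientable surfaces with boundary
circles labelled by `B`. -/
def Surface (B : Type) : Type := Quotient (surfaceSetoid B)

namespace Surface

/-- The surface with (finite) set of components `K`, genus function `g`, in which the boundary
circle `b` lies on the component `p b`. -/
def of {B K : Type} [Finite K] (g : K → ℕ) (p : B → K) : Surface B :=
  Quotient.mk (surfaceSetoid B)
    ⟨Nat.card K, g ∘ (Finite.equivFin K).symm, Finite.equivFin K ∘ p⟩

theorem of_eq_of {B K L : Type} [Finite K] [Finite L] {g : K → ℕ} {p : B → K} {g' : L → ℕ}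
    {p' : B → L} (e : K ≃ L) (hg : ∀ k, g' (e k) = g k) (hp : ∀ b, p' b = e (p b)) :
    of g p = of g' p' := by
  refine Quotient.sound ⟨(Finite.equivFin K).symm.trans (e.trans (Finite.equivFin L)), ?_, ?_⟩
  · intro k; simp [hg]
  · intro b; simp [hp]

theorem exists_of {B : Type} (C : Surface B) :
    ∃ (n : ℕ) (g : Fin n → ℕ) (p : B → Fin n), C = of g p := by
  obtain ⟨⟨n, g, p⟩, rfl⟩ := Quotient.exists_rep C
  refine ⟨n, g, p, Quotient.sound ⟨Finite.equivFin (Fin n), ?_, ?_⟩⟩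
  · intro k; simp
  · intro b; simp

/-! ### Attaching tubes -/

section Tubes

variable {B K E : Type}

/-- The components after attaching, for every `e : E`, a tube that joins a small disc on the
component `s e` to a small disc on the component `t e` (the two discs being removed). -/
abbrev TubeComp (s t : E → K) : Type := Quot fun a b => ∃ e, s e = a ∧ t e = b

/-- The genus of a component `q` after attaching tubes: if it arises from `v` old components joined
by `r` tubes, its genus is the sum of the old genera plus the number `r - (v - 1)` of independent
cycles of tubes. This is additivity of the Euler characteristic; by connectedness of `q` one always
has `v ≤ r + 1`, so that the subtraction is not truncated (`card_le_of_tube`). -/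
def tubeGenus (g : K → ℕ) (s t : E → K) (q : TubeComp s t) : ℕ :=
  (∑ᶠ k : {k : K // Quot.mk _ k = q}, g k) + Nat.card {e : E // Quot.mk _ (s e) = q} + 1
    - Nat.card {k : K // (Quot.mk _ k : TubeComp s t) = q}

/-- The surface obtained from the surface with components `K`, genera `g` and boundary circles
attached by `p`, by attaching a tube between `s e` and `t e` for each `e : E`. -/
def tubes [Finite K] (g : K → ℕ) (p : B → K) (s t : E → K) : Surface B :=
  of (tubeGenus g s t) fun b => (Quot.mk _ (p b) : TubeComp s t)

theorem card_le_of_tube [Finite E] (s t : E → K) (q : TubeComp s t) :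
    Nat.card {k : K // (Quot.mk _ k : TubeComp s t) = q}
      ≤ Nat.card {e : E // (Quot.mk _ (s e) : TubeComp s t) = q} + 1 := by
  let V := {k : K // (Quot.mk _ k : TubeComp s t) = q}
  let F := {e : E // (Quot.mk _ (s e) : TubeComp s t) = q}
  have hst : ∀ e, (Quot.mk _ (s e) : TubeComp s t) = Quot.mk _ (t e) :=
    fun e => Quot.sound ⟨e, rfl, rfl⟩
  let a : F → V := fun e => ⟨s e.1, e.2⟩
  let b : F → V := fun e => ⟨t e.1, (hst e.1).symm.trans e.2⟩
  let G : SimpleGraph V := SimpleGraph.fromRel fun x y => ∃ e, a e = x ∧ b e = y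
  have key : ∀ x y : K, Relation.EqvGen (fun x y => ∃ e, s e = x ∧ t e = y) x y →
      ∀ (hx : (Quot.mk _ x : TubeComp s t) = q) (hy : (Quot.mk _ y : TubeComp s t) = q),
        G.Reachable ⟨x, hx⟩ ⟨y, hy⟩ := by
    intro x y h
    induction h with
    | rel x y h =>
      intro hx hy
      obtain ⟨e, rfl, rfl⟩ := h
      by_cases hne : (⟨s e, hx⟩ : V) = ⟨t e, hy⟩
      · rw [hne]
      · exact SimpleGraph.Adj.reachable
          ((SimpleGraph.fromRel_adj _ _ _).2 ⟨hne, Or.inl ⟨⟨e, hx⟩, rfl, rfl⟩⟩)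
    | refl x => intro hx hy; exact SimpleGraph.Reachable.refl _
    | symm x y _ ih => intro hx hy; exact (ih hy hx).symm
    | trans x y z h1 _ ih1 ih2 =>
      intro hx hz
      have hy : (Quot.mk _ y : TubeComp s t) = q := (Quot.eqvGen_sound h1).symm.trans hx
      exact (ih1 hx hy).trans (ih2 hy hz)
  have hconn : G.Connected := by
    have : Nonempty V := by
      obtain ⟨k, rfl⟩ := Quot.exists_rep q
      exact ⟨⟨k, rfl⟩⟩
    refine SimpleGraph.Connected.mk ?_
    rintro ⟨x, hx⟩ ⟨y, hy⟩
    exact key x y (Quot.eqvGen_exact (hx.trans hy.symm)) hx hy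
  refine hconn.card_vert_le_card_edgeSet_add_one.trans (Nat.add_le_add_right ?_ 1)
  have hedge : ∀ z : G.edgeSet, ∃ e : F, s(a e, b e) = z.1 := by
    rintro ⟨z, hz⟩
    induction z using Sym2.ind with
    | _ x y =>
      have hxy : G.Adj x y := hz
      obtain ⟨_, ⟨e, rfl, rfl⟩ | ⟨e, rfl, rfl⟩⟩ := (SimpleGraph.fromRel_adj _ x y).1 hxy
      · exact ⟨e, rfl⟩
      · exact ⟨e, Sym2.eq_swap⟩
  choose f hf using hedge
  exact Nat.card_le_card_of_injective f fun z w h =>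
    Subtype.ext (by rw [← hf z, ← hf w, h])

/-- The genera after attaching tubes, tested against an arbitrary function of the component. -/
theorem tubeGenus_sum [Fintype K] [Fintype E] (g : K → ℕ) (s t : E → K)
    [Fintype (TubeComp s t)] (φ : TubeComp s t → ℤ) :
    ∑ q, φ q * ((tubeGenus g s t q : ℤ) - 1)
      = ∑ k, φ (Quot.mk _ k) * ((g k : ℤ) - 1) + ∑ e, φ (Quot.mk _ (s e)) := by
  classical
  have hcast : ∀ q, (tubeGenus g s t q : ℤ) - 1
      = (∑ k : {k : K // (Quot.mk _ k : TubeComp s t) = q}, ((g k : ℤ) - 1))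
        + Nat.card {e : E // (Quot.mk _ (s e) : TubeComp s t) = q} := by
    intro q
    have h := card_le_of_tube s t q
    rw [tubeGenus, finsum_eq_sum_of_fintype, Nat.cast_sub (by lia), Finset.sum_sub_distrib]
    simp only [Finset.sum_const, Finset.card_univ, Nat.card_eq_fintype_card]
    push_cast
    ring
  simp_rw [hcast, mul_add, Finset.sum_add_distrib]
  congr 1
  · rw [← Fintype.sum_fiberwise (fun k : K => (Quot.mk _ k : TubeComp s t))]
    refine Finset.sum_congr rfl fun q _ => ?_
    rw [Finset.mul_sum]
    refine Finset.sum_congr rfl fun k _ => ?_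
    rw [k.2]
  · rw [← Fintype.sum_fiberwise (fun e : E => (Quot.mk _ (s e) : TubeComp s t))]
    refine Finset.sum_congr rfl fun q _ => ?_
    rw [Finset.sum_congr rfl fun e _ => by rw [e.2]]
    simp [Nat.card_eq_fintype_card, mul_comm]

/-- Recognition of the result of attaching tubes. -/
theorem of_eq_tubes {L : Type} [Fintype K] [Fintype E] [Fintype L] {g : K → ℕ} {p : B → K}
    {s t : E → K} {g' : L → ℕ} {p' : B → L} (π : K → L) (ρ : L → TubeComp s t)
    (hπ : Function.Surjective π) (hst : ∀ e, π (s e) = π (t e))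
    (hρ : ∀ k, ρ (π k) = Quot.mk _ k) (hp : ∀ b, p' b = π (p b))
    (hg : ∀ φ : L → ℤ, ∑ l, φ l * ((g' l : ℤ) - 1)
      = ∑ k, φ (π k) * ((g k : ℤ) - 1) + ∑ e, φ (π (s e))) :
    of g' p' = tubes g p s t := by
  classical
  have : Fintype (TubeComp s t) := Fintype.ofFinite _
  let e : TubeComp s t ≃ L :=
    { toFun := Quot.lift π (by rintro _ _ ⟨e, rfl, rfl⟩; exact hst e)
      invFun := ρ
      left_inv := by rintro ⟨k⟩; exact hρ k
      right_inv := by intro l; obtain ⟨k, rfl⟩ := hπ l; rw [hρ] }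
  symm
  refine of_eq_of e ?_ ?_
  · intro q
    have h1 := tubeGenus_sum g s t (Pi.single q 1)
    have h2 := hg (Pi.single (e q) 1)
    have h3 : ∀ k, (Pi.single (e q) 1 : L → ℤ) (π k)
        = (Pi.single q 1 : TubeComp s t → ℤ) (Quot.mk _ k) := by
      intro k
      have : π k = e (Quot.mk _ k) := rfl
      rw [this]
      simp [Pi.single_apply]
    simp_rw [h3] at h2
    rw [← h1] at h2
    simp [Pi.single_apply] at h2
    exact h2
  · intro b; exact hp b

end Tubes
/-- Relabelling the components and the tubes. -/
theorem tubes_congr {B K E K' E' : Type} [Finite K] [Finite K'] [Finite E] [Finite E']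
    {g : K → ℕ} {p : B → K} {s t : E → K} {g' : K' → ℕ} {p' : B → K'} {s' t' : E' → K'}
    (α : K ≃ K') (ε : E ≃ E') (hg : ∀ k, g' (α k) = g k) (hp : ∀ b, p' b = α (p b))
    (hs : ∀ e, s' (ε e) = α (s e)) (ht : ∀ e, t' (ε e) = α (t e)) :
    tubes g p s t = tubes g' p' s' t' := by
  have := Fintype.ofFinite K
  have := Fintype.ofFinite K'
  have := Fintype.ofFinite E
  have := Fintype.ofFinite E'
  have := Fintype.ofFinite (TubeComp s t)
  refine of_eq_tubes (fun k => Quot.mk _ (α.symm k))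
    (Quot.lift (fun k => Quot.mk _ (α k)) ?_) ?_ ?_ ?_ ?_ ?_
  · rintro _ _ ⟨e, rfl, rfl⟩
    exact Quot.sound ⟨ε e, hs e, ht e⟩
  · rintro ⟨k⟩
    exact ⟨α k, by simp⟩
  · intro e
    obtain ⟨e, rfl⟩ := ε.surjective e
    rw [hs, ht, α.symm_apply_apply, α.symm_apply_apply]
    exact Quot.sound ⟨e, rfl, rfl⟩
  · intro k; simp
  · intro b; simp [hp]
  · intro φ
    rw [tubeGenus_sum, ← α.sum_comp, ← ε.sum_comp]
    simp [hg, hs]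

/-- Attaching tubes in two steps, the first ones between components of a part `K` of the
surface. -/
theorem tubes_tubes_inl {B K L E F : Type} [Finite K] [Finite L] [Finite E] [Finite F]
    (g : K → ℕ) (g' : L → ℕ) (s t : E → K) (p : B → K ⊕ L) (u v : F → K ⊕ L) :
    tubes (Sum.elim (tubeGenus g s t) g') (fun b => Sum.map (Quot.mk _) id (p b))
        (fun f => Sum.map (Quot.mk _) id (u f)) (fun f => Sum.map (Quot.mk _) id (v f))
      = tubes (Sum.elim g g') p (Sum.elim (fun e => Sum.inl (s e)) u)
          (Sum.elim (fun e => Sum.inl (t e)) v) := by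
  have := Fintype.ofFinite K
  have := Fintype.ofFinite L
  have := Fintype.ofFinite E
  have := Fintype.ofFinite F
  have := Fintype.ofFinite (TubeComp s t)
  let u' : F → TubeComp s t ⊕ L := fun f => Sum.map (Quot.mk _) id (u f)
  let v' : F → TubeComp s t ⊕ L := fun f => Sum.map (Quot.mk _) id (v f)
  have := Fintype.ofFinite (TubeComp u' v')
  let s'' : E ⊕ F → K ⊕ L := Sum.elim (fun e => Sum.inl (s e)) u
  let t'' : E ⊕ F → K ⊕ L := Sum.elim (fun e => Sum.inl (t e)) v
  let ρ : TubeComp s t ⊕ L → TubeComp s'' t'' :=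
    Sum.elim (Quot.lift (fun k => Quot.mk _ (Sum.inl k))
      (by rintro _ _ ⟨e, rfl, rfl⟩; exact Quot.sound ⟨Sum.inl e, rfl, rfl⟩))
      (fun l => Quot.mk _ (Sum.inr l))
  have hρ : ∀ x : K ⊕ L, ρ (Sum.map (Quot.mk _) id x) = Quot.mk _ x := by
    rintro (k | l) <;> rfl
  refine of_eq_tubes (fun x => (Quot.mk _ (Sum.map (Quot.mk _) id x) : TubeComp u' v'))
    (Quot.lift ρ ?_) ?_ ?_ ?_ ?_ ?_
  · rintro _ _ ⟨f, rfl, rfl⟩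
    rw [hρ, hρ]
    exact Quot.sound ⟨Sum.inr f, rfl, rfl⟩
  · rintro ⟨q | l⟩
    · obtain ⟨k, rfl⟩ := Quot.exists_rep q
      exact ⟨Sum.inl k, rfl⟩
    · exact ⟨Sum.inr l, rfl⟩
  · rintro (e | f)
    · have h : (Quot.mk _ (s e) : TubeComp s t) = Quot.mk _ (t e) := Quot.sound ⟨e, rfl, rfl⟩
      simp [h]
    · exact Quot.sound ⟨f, rfl, rfl⟩
  · intro k; exact hρ k
  · intro b; rfl
  · intro φ
    rw [tubeGenus_sum]
    simp only [Fintype.sum_sum_type, Sum.elim_inl, Sum.elim_inr, Sum.map_inl, Sum.map_inr, id]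
    rw [tubeGenus_sum g s t (fun q => φ (Quot.mk _ (Sum.inl q)))]
    ring

/-! ### Disjoint union and gluing -/

/-- The disjoint union of a cobordism from `S` to `T` and a cobordism from `S'` to `T'`. -/
def disj {S T S' T' : Type} (C : Surface (S ⊕ T)) (D : Surface (S' ⊕ T')) :
    Surface ((S ⊕ S') ⊕ (T ⊕ T')) :=
  Quotient.liftOn₂ C D
    (fun x y => of (Sum.elim x.2.1 y.2.1)
      (Sum.elim (Sum.map (x.2.2 ∘ Sum.inl) (y.2.2 ∘ Sum.inl))
        (Sum.map (x.2.2 ∘ Sum.inr) (y.2.2 ∘ Sum.inr))))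
    (by
      rintro x y x' y' ⟨α, h1, h2⟩ ⟨β, h3, h4⟩
      refine of_eq_of (Equiv.sumCongr α β) ?_ ?_
      · rintro (k | k) <;> simp [h1, h3]
      · rintro ((b | b) | (b | b)) <;> simp [h2, h4])

/-- The composite of a cobordism `C` from `S` to `T` and a cobordism `D` from `T` to `U`, obtained
by gluing them along the circles `T`. Gluing two surfaces along a boundary circle amounts to
attaching a tube between the components that contain it, once the circle is capped off by discs. -/
def comp {S T U : Type} [Finite T] (C : Surface (S ⊕ T)) (D : Surface (T ⊕ U)) :
    Surface (S ⊕ U) :=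
  Quotient.liftOn₂ C D
    (fun x y => tubes (Sum.elim x.2.1 y.2.1) (Sum.map (x.2.2 ∘ Sum.inl) (y.2.2 ∘ Sum.inr))
      (fun b : T => Sum.inl (x.2.2 (Sum.inr b))) (fun b : T => Sum.inr (y.2.2 (Sum.inl b))))
    (by
      rintro x y x' y' ⟨α, h1, h2⟩ ⟨β, h3, h4⟩
      refine tubes_congr (Equiv.sumCongr α β) (Equiv.refl T) ?_ ?_ ?_ ?_
      · rintro (k | k) <;> simp [h1, h3]
      · rintro (b | b) <;> simp [h2, h4]
      · intro b; simp [h2]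
      · intro b; simp [h4])

section Comp

variable {S T U K L E : Type} [Finite T] [Finite K] [Finite L] [Finite E]

theorem comp_of (g : K → ℕ) (p : S ⊕ T → K) (g' : L → ℕ) (p' : T ⊕ U → L) :
    comp (of g p) (of g' p')
      = tubes (Sum.elim g g') (Sum.map (p ∘ Sum.inl) (p' ∘ Sum.inr))
          (fun b : T => Sum.inl (p (Sum.inr b))) (fun b : T => Sum.inr (p' (Sum.inl b))) := by
  symm
  refine tubes_congr (Equiv.sumCongr (Finite.equivFin K) (Finite.equivFin L)) (Equiv.refl T)
    ?_ ?_ ?_ ?_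
  · rintro (k | k) <;> simp
  · rintro (b | b) <;> simp
  · intro b; simp
  · intro b; simp

theorem comp_tubes_left (g : K → ℕ) (p : S ⊕ T → K) (s t : E → K) (g' : L → ℕ)
    (p' : T ⊕ U → L) :
    comp (tubes g p s t) (of g' p')
      = tubes (Sum.elim g g') (Sum.map (p ∘ Sum.inl) (p' ∘ Sum.inr))
          (Sum.elim (fun e => Sum.inl (s e)) fun b : T => Sum.inl (p (Sum.inr b)))
          (Sum.elim (fun e => Sum.inl (t e)) fun b : T => Sum.inr (p' (Sum.inl b))) := by
  rw [← tubes_tubes_inl, tubes, comp_of]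
  refine tubes_congr (Equiv.refl _) (Equiv.refl T) (fun _ => rfl) ?_ (fun _ => rfl) (fun _ => rfl)
  rintro (b | b) <;> rfl

theorem comp_tubes_right (g : K → ℕ) (p : T ⊕ U → K) (s t : E → K) (g' : L → ℕ)
    (p' : S ⊕ T → L) :
    comp (of g' p') (tubes g p s t)
      = tubes (Sum.elim g' g) (Sum.map (p' ∘ Sum.inl) (p ∘ Sum.inr))
          (Sum.elim (fun e => Sum.inr (s e)) fun b : T => Sum.inl (p' (Sum.inr b)))
          (Sum.elim (fun e => Sum.inr (t e)) fun b : T => Sum.inr (p (Sum.inl b))) := by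
  rw [tubes, comp_of]
  trans tubes (Sum.elim g g') (fun b => (Sum.map (p' ∘ Sum.inl) (p ∘ Sum.inr) b).swap)
    (Sum.elim (fun e => Sum.inl (s e)) fun b : T => Sum.inr (p' (Sum.inr b)))
    (Sum.elim (fun e => Sum.inl (t e)) fun b : T => Sum.inl (p (Sum.inl b)))
  · rw [← tubes_tubes_inl]
    refine tubes_congr (Equiv.sumComm _ _) (Equiv.refl T) ?_ ?_ (fun _ => rfl) (fun _ => rfl)
    · rintro (k | k) <;> rfl
    · rintro (b | b) <;> rfl
  · refine tubes_congr (Equiv.sumComm _ _) (Equiv.refl _) ?_ ?_ ?_ ?_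
    · rintro (k | k) <;> rfl
    · rintro (b | b) <;> rfl
    · rintro (b | b) <;> rfl
    · rintro (b | b) <;> rfl

theorem comp_assoc {V : Type} [Finite U] (C : Surface (S ⊕ T)) (D : Surface (T ⊕ U))
    (F : Surface (U ⊕ V)) : comp (comp C D) F = comp C (comp D F) := by
  obtain ⟨_, g, p, rfl⟩ := C.exists_of
  obtain ⟨_, g', p', rfl⟩ := D.exists_of
  obtain ⟨_, g'', p'', rfl⟩ := F.exists_of
  rw [comp_of, comp_of, comp_tubes_left, comp_tubes_right]
  refine tubes_congr (Equiv.sumAssoc _ _ _) (Equiv.sumComm _ _) ?_ ?_ ?_ ?_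
  · rintro ((k | k) | k) <;> rfl
  · rintro (b | b) <;> rfl
  · rintro (b | b) <;> rfl
  · rintro (b | b) <;> rfl

/-- The union of cylinders that joins, for a bijection `e : S ≃ T`, the circle `b` of the source
to the circle `e b` of the target. -/
def cyl {S T : Type} [Finite S] (e : S ≃ T) : Surface (S ⊕ T) :=
  of (fun _ : S => 0) (Sum.elim id e.symm)

theorem cyl_comp (C : Surface (T ⊕ U)) : comp (cyl (Equiv.refl T)) C = C := by
  obtain ⟨_, g, p, rfl⟩ := C.exists_of
  have := Fintype.ofFinite T
  rw [cyl, comp_of]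
  symm
  refine of_eq_tubes (Sum.elim (fun b => p (Sum.inl b)) id) (fun k => Quot.mk _ (Sum.inr k))
    ?_ ?_ ?_ ?_ ?_
  · intro k; exact ⟨Sum.inr k, rfl⟩
  · intro b; rfl
  · rintro (b | k)
    · exact (Quot.sound ⟨b, rfl, rfl⟩ : _ = _).symm
    · rfl
  · rintro (b | b) <;> rfl
  · intro φ
    simp [Fintype.sum_sum_type]

theorem comp_cyl (C : Surface (S ⊕ T)) : comp C (cyl (Equiv.refl T)) = C := by
  obtain ⟨_, g, p, rfl⟩ := C.exists_of
  have := Fintype.ofFinite T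
  rw [cyl, comp_of]
  symm
  refine of_eq_tubes (Sum.elim id (fun b => p (Sum.inr b))) (fun k => Quot.mk _ (Sum.inl k))
    ?_ ?_ ?_ ?_ ?_
  · intro k; exact ⟨Sum.inl k, rfl⟩
  · intro b; rfl
  · rintro (k | b)
    · rfl
    · exact Quot.sound ⟨b, rfl, rfl⟩
  · rintro (b | b) <;> rfl
  · intro φ
    simp [Fintype.sum_sum_type]

end Comp

/-! ### The local relations -/

/-- The surface given by `g` and `p`, together with an additional closed component of genus `c`. -/
def addClosed {B K : Type} [Finite K] (g : K → ℕ) (p : B → K) (c : ℕ) : Surface B :=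
  of (Sum.elim g fun _ : Unit => c) fun b => Sum.inl (p b)

/-- The surface given by `g` and `p`, with a tube between a disc on the component `i` and a disc
on the component `j` (which may be equal: then a handle is added). -/
def addTube {B K : Type} [Finite K] (g : K → ℕ) (p : B → K) (i j : K) : Surface B :=
  tubes g p (fun _ : Unit => i) fun _ : Unit => j

/-- The local relations among formal linear combinations of surfaces with boundary `B`:
* 4TU: `C₁₂ + C₃₄ = C₁₃ + C₂₄` for four disjoint discs on a surface `C` (here numbered from `0`),
  lying on the arbitrary components `D 0`, `D 1`, `D 2`, `D 3`, where `Cᵢⱼ` is `C` with the `i`-th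
  and the `j`-th disc replaced by a tube;
* S: a surface with a closed component of genus `0` vanishes;
* T: a closed component of genus `1` may be replaced by the factor `2`. -/
inductive IsLocalRel (k : Type) [CommRing k] {B : Type} : (Surface B →₀ k) → Prop
  | fourTu {K : Type} [Finite K] (g : K → ℕ) (p : B → K) (D : Fin 4 → K) :
      IsLocalRel k
        (Finsupp.single (addTube g p (D 0) (D 1)) 1 + Finsupp.single (addTube g p (D 2) (D 3)) 1
          - Finsupp.single (addTube g p (D 0) (D 2)) 1
          - Finsupp.single (addTube g p (D 1) (D 3)) 1)
  | sphere {K : Type} [Finite K] (g : K → ℕ) (p : B → K) :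
      IsLocalRel k (Finsupp.single (addClosed g p 0) 1)
  | torus {K : Type} [Finite K] (g : K → ℕ) (p : B → K) :
      IsLocalRel k (Finsupp.single (addClosed g p 1) 1 - Finsupp.single (of g p) 2)

theorem tubes_tubes {B K E F : Type} [Finite K] [Finite E] [Finite F]
    (g : K → ℕ) (s t : E → K) (p : B → K) (u v : F → K) :
    tubes (tubeGenus g s t) (fun b => Quot.mk _ (p b)) (fun f => Quot.mk _ (u f))
        (fun f => Quot.mk _ (v f))
      = tubes g p (Sum.elim s u) (Sum.elim t v) := by
  trans tubes (Sum.elim g (Empty.elim : Empty → ℕ)) (fun b => Sum.inl (p b))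
    (Sum.elim (fun e => Sum.inl (s e)) fun f => Sum.inl (u f))
    (Sum.elim (fun e => Sum.inl (t e)) fun f => Sum.inl (v f))
  · rw [← tubes_tubes_inl]
    exact tubes_congr (Equiv.sumEmpty _ _).symm (Equiv.refl _) (fun _ => rfl) (fun _ => rfl)
      (fun _ => rfl) (fun _ => rfl)
  · refine tubes_congr (Equiv.sumEmpty _ _) (Equiv.refl _) ?_ (fun _ => rfl) ?_ ?_
    · rintro (k | k)
      · rfl
      · exact k.elim
    · rintro (e | e) <;> rfl
    · rintro (e | e) <;> rfl

theorem tubes_addClosed {B K E : Type} [Finite K] [Finite E] (g : K → ℕ) (p : B → K)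
    (s t : E → K) (c : ℕ) :
    addClosed (tubeGenus g s t) (fun b => (Quot.mk _ (p b) : TubeComp s t)) c
      = tubes (Sum.elim g fun _ : Unit => c) (fun b => Sum.inl (p b)) (fun e => Sum.inl (s e))
          (fun e => Sum.inl (t e)) := by
  have := Fintype.ofFinite K
  have := Fintype.ofFinite E
  have := Fintype.ofFinite (TubeComp s t)
  refine of_eq_tubes (Sum.map (Quot.mk _) id)
    (Sum.elim (Quot.lift (fun k => Quot.mk _ (Sum.inl k)) ?_) fun l => Quot.mk _ (Sum.inr l))
    ?_ ?_ ?_ (fun _ => rfl) ?_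
  · rintro _ _ ⟨e, rfl, rfl⟩
    exact Quot.sound ⟨e, rfl, rfl⟩
  · rintro (q | l)
    · obtain ⟨k, rfl⟩ := Quot.exists_rep q
      exact ⟨Sum.inl k, rfl⟩
    · exact ⟨Sum.inr l, rfl⟩
  · intro e
    exact congrArg Sum.inl (Quot.sound ⟨e, rfl, rfl⟩)
  · rintro (k | l) <;> rfl
  · intro φ
    simp only [Fintype.sum_sum_type, Sum.elim_inl, Sum.elim_inr, Sum.map_inl, Sum.map_inr, id]
    rw [tubeGenus_sum g s t (fun q => φ (Sum.inl q))]
    ring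

section LocalRel

variable {S T U : Type} [Finite T]

variable {K L : Type} [Finite K] [Finite L]

theorem comp_addTube (g : K → ℕ) (p : S ⊕ T → K) (i j : K) (g' : L → ℕ) (p' : T ⊕ U → L) :
    comp (addTube g p i j) (of g' p')
      = addTube (tubeGenus (Sum.elim g g') (fun b : T => Sum.inl (p (Sum.inr b)))
            (fun b : T => Sum.inr (p' (Sum.inl b))))
          (fun b => Quot.mk _ (Sum.map (p ∘ Sum.inl) (p' ∘ Sum.inr) b))
          (Quot.mk _ (Sum.inl i)) (Quot.mk _ (Sum.inl j)) := by
  rw [addTube, addTube, comp_tubes_left, tubes_tubes (u := fun _ : Unit => Sum.inl i)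
    (v := fun _ : Unit => Sum.inl j)]
  refine tubes_congr (Equiv.refl _) (Equiv.sumComm _ _) (fun _ => rfl) (fun _ => rfl) ?_ ?_
  · rintro (e | e) <;> rfl
  · rintro (e | e) <;> rfl

theorem comp_addTube' (g : K → ℕ) (p : S ⊕ T → K) (g' : L → ℕ) (p' : T ⊕ U → L) (i j : L) :
    comp (of g p) (addTube g' p' i j)
      = addTube (tubeGenus (Sum.elim g g') (fun b : T => Sum.inl (p (Sum.inr b)))
            (fun b : T => Sum.inr (p' (Sum.inl b))))
          (fun b => Quot.mk _ (Sum.map (p ∘ Sum.inl) (p' ∘ Sum.inr) b))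
          (Quot.mk _ (Sum.inr i)) (Quot.mk _ (Sum.inr j)) := by
  rw [addTube, addTube, comp_tubes_right, tubes_tubes (u := fun _ : Unit => Sum.inr i)
    (v := fun _ : Unit => Sum.inr j)]
  refine tubes_congr (Equiv.refl _) (Equiv.sumComm _ _) (fun _ => rfl) (fun _ => rfl) ?_ ?_
  · rintro (e | e) <;> rfl
  · rintro (e | e) <;> rfl

theorem comp_addClosed (g : K → ℕ) (p : S ⊕ T → K) (c : ℕ) (g' : L → ℕ) (p' : T ⊕ U → L) :
    comp (addClosed g p c) (of g' p')
      = addClosed (tubeGenus (Sum.elim g g') (fun b : T => Sum.inl (p (Sum.inr b)))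
            (fun b : T => Sum.inr (p' (Sum.inl b))))
          (fun b => Quot.mk _ (Sum.map (p ∘ Sum.inl) (p' ∘ Sum.inr) b)) c := by
  rw [tubes_addClosed, addClosed, comp_of]
  refine tubes_congr ((Equiv.sumAssoc _ _ _).trans (((Equiv.refl _).sumCongr
    (Equiv.sumComm _ _)).trans (Equiv.sumAssoc _ _ _).symm)) (Equiv.refl _) ?_ ?_
    (fun _ => rfl) (fun _ => rfl)
  · rintro ((k | k) | k) <;> rfl
  · rintro (b | b) <;> rfl

theorem comp_addClosed' (g : K → ℕ) (p : S ⊕ T → K) (c : ℕ) (g' : L → ℕ) (p' : T ⊕ U → L) :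
    comp (of g p) (addClosed g' p' c)
      = addClosed (tubeGenus (Sum.elim g g') (fun b : T => Sum.inl (p (Sum.inr b)))
            (fun b : T => Sum.inr (p' (Sum.inl b))))
          (fun b => Quot.mk _ (Sum.map (p ∘ Sum.inl) (p' ∘ Sum.inr) b)) c := by
  rw [tubes_addClosed, addClosed, comp_of]
  refine tubes_congr (Equiv.sumAssoc _ _ _).symm (Equiv.refl _) ?_ ?_
    (fun _ => rfl) (fun _ => rfl)
  · rintro (k | k | k) <;> rfl
  · rintro (b | b) <;> rfl

theorem IsLocalRel.comp_right {k : Type} [CommRing k] {f : Surface (S ⊕ T) →₀ k}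
    (h : IsLocalRel k f) (C : Surface (T ⊕ U)) :
    IsLocalRel k (f.mapDomain fun F => comp F C) := by
  obtain ⟨_, g', p', rfl⟩ := C.exists_of
  cases h with
  | fourTu g p D =>
    simpa only [sub_eq_add_neg, ← Finsupp.single_neg, Finsupp.mapDomain_add,
      Finsupp.mapDomain_single, comp_addTube] using
      IsLocalRel.fourTu (k := k) _ _ fun i => Quot.mk _ (Sum.inl (D i))
  | sphere g p =>
    rw [Finsupp.mapDomain_single, comp_addClosed]
    exact .sphere _ _
  | torus g p =>
    simpa only [sub_eq_add_neg, ← Finsupp.single_neg, Finsupp.mapDomain_add,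
      Finsupp.mapDomain_single, comp_addClosed, comp_of, tubes] using
      IsLocalRel.torus (k := k) (B := S ⊕ U) _ _

theorem IsLocalRel.comp_left {k : Type} [CommRing k] {f : Surface (T ⊕ U) →₀ k}
    (h : IsLocalRel k f) (C : Surface (S ⊕ T)) :
    IsLocalRel k (f.mapDomain fun F => comp C F) := by
  obtain ⟨_, g', p', rfl⟩ := C.exists_of
  cases h with
  | fourTu g p D =>
    simpa only [sub_eq_add_neg, ← Finsupp.single_neg, Finsupp.mapDomain_add,
      Finsupp.mapDomain_single, comp_addTube'] using
      IsLocalRel.fourTu (k := k) _ _ fun i => Quot.mk _ (Sum.inr (D i))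
  | sphere g p =>
    rw [Finsupp.mapDomain_single, comp_addClosed']
    exact .sphere _ _
  | torus g p =>
    simpa only [sub_eq_add_neg, ← Finsupp.single_neg, Finsupp.mapDomain_add,
      Finsupp.mapDomain_single, comp_addClosed', comp_of, tubes] using
      IsLocalRel.torus (k := k) (B := S ⊕ U) _ _

/-- The linear combinations of surfaces that vanish modulo the local relations. -/
def localRel (k : Type) [CommRing k] (B : Type) : Submodule k (Surface B →₀ k) :=
  Submodule.span k {f | IsLocalRel k f}

end LocalRel

/-- The connected surface of genus `g` with boundary circles `B`. -/
def connected (B : Type) (g : ℕ) : Surface B := of (fun _ : Unit => g) fun _ => ()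

end Surface

/-! ### The cobordism category -/

/-- An object of the category of two-dimensional cobordisms: a disjoint union of finitely many
(oriented) circles, indexed by `carrier`. Up to homeomorphism relative to the boundary, an oriented
cobordism is determined by its components, their genera, and the distribution of the boundary
circles among the components. -/
structure Cob where
  carrier : Type
  [finite : Finite carrier]

namespace Cob

attribute [instance] Cob.finite

instance : CoeSort Cob Type := ⟨Cob.carrier⟩

/-- A cobordism from `S` to `T` is a surface with boundary `S ⊕ T`; composition is gluing. -/
instance : Category Cob where
  Hom S T := Surface (S ⊕ T)
  id S := Surface.cyl (Equiv.refl S)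
  comp C D := Surface.comp C D
  id_comp C := Surface.cyl_comp C
  comp_id C := Surface.comp_cyl C
  assoc C D F := Surface.comp_assoc C D F

/-- The empty object. -/
def empty : Cob := ⟨Empty⟩

/-- One circle. -/
def circle : Cob := ⟨Unit⟩

instance : IsEmpty empty := inferInstanceAs (IsEmpty Empty)

instance : Unique circle := inferInstanceAs (Unique Unit)

/-- Disjoint union of objects. -/
def union (S T : Cob) : Cob := ⟨S ⊕ T⟩

/-- Disjoint union of cobordisms. -/
def unionHom {S T S' T' : Cob} (C : S ⟶ T) (D : S' ⟶ T') : S.union S' ⟶ T.union T' :=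
  Surface.disj C D

/-- The cylinders along a bijection of the sets of circles. -/
def cyl {S T : Cob} (e : S ≃ T) : S ⟶ T := Surface.cyl e

/-- The connected cobordism of genus `g` from `S` to `T`. -/
def connected (S T : Cob) (g : ℕ) : S ⟶ T := Surface.connected (S ⊕ T) g

end Cob

/-! ### Cobordisms modulo the local relations -/

namespace Surface

/-- Formal `k`-linear combinations of surfaces with boundary `B`, modulo the local relations. -/
abbrev ModRel (k : Type) [CommRing k] (B : Type) : Type := (Surface B →₀ k) ⧸ localRel k B

variable (k : Type) [CommRing k]

/-- The class of a surface modulo the local relations. -/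
def toModRel {B : Type} (C : Surface B) : ModRel k B :=
  Submodule.Quotient.mk (Finsupp.single C 1)

variable {k}

theorem modRel_induction {B : Type} {P : ModRel k B → Prop} (x : ModRel k B)
    (of : ∀ C : Surface B, P (toModRel k C)) (add : ∀ x y, P x → P y → P (x + y))
    (smul : ∀ (r : k) x, P x → P (r • x)) (zero : P 0) : P x := by
  induction x using Submodule.Quotient.induction_on with
  | _ f =>
    induction f using Finsupp.induction_linear with
    | zero => exact zero
    | add f g hf hg => exact add _ _ hf hg
    | single C r =>
      rw [← mul_one r, ← smul_eq_mul, ← Finsupp.smul_single]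
      exact smul r _ (of C)

variable (k)

/-- Bilinear extension of the composition of cobordisms. -/
def compFree (S T U : Type) [Finite T] :
    (Surface (S ⊕ T) →₀ k) →ₗ[k] (Surface (T ⊕ U) →₀ k) →ₗ[k] (Surface (S ⊕ U) →₀ k) :=
  Finsupp.linearCombination k fun C => Finsupp.lmapDomain k k fun D => comp C D

theorem compFree_single_left {S T U : Type} [Finite T] (C : Surface (S ⊕ T))
    (f : Surface (T ⊕ U) →₀ k) :
    compFree k S T U (Finsupp.single C 1) f = f.mapDomain fun D => comp C D := by
  simp [compFree]

theorem compFree_single_right {S T U : Type} [Finite T] (f : Surface (S ⊕ T) →₀ k)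
    (D : Surface (T ⊕ U)) :
    compFree k S T U f (Finsupp.single D 1) = f.mapDomain fun C => comp C D := by
  have h : (compFree k S T U).flip (Finsupp.single D 1)
      = Finsupp.lmapDomain k k fun C => comp C D := by
    refine Finsupp.lhom_ext' fun C => LinearMap.ext_ring ?_
    simp [compFree]
  exact LinearMap.congr_fun h f

theorem compFree_mem_left {S T U : Type} [Finite T] {f : Surface (S ⊕ T) →₀ k}
    (hf : f ∈ localRel k (S ⊕ T)) (f' : Surface (T ⊕ U) →₀ k) :
    compFree k S T U f f' ∈ localRel k (S ⊕ U) := by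
  induction hf using Submodule.span_induction with
  | mem f hf =>
    induction f' using Finsupp.induction_linear with
    | zero => simp
    | add x y hx hy => rw [map_add]; exact add_mem hx hy
    | single D r =>
      rw [← mul_one r, ← smul_eq_mul, ← Finsupp.smul_single, map_smul, compFree_single_right]
      exact Submodule.smul_mem _ _ (Submodule.subset_span (hf.comp_right D))
  | zero => simp
  | add x y _ _ hx hy => rw [map_add]; exact add_mem hx hy
  | smul r x _ hx => rw [map_smul]; exact Submodule.smul_mem _ _ hx

theorem compFree_mem_right {S T U : Type} [Finite T] (f : Surface (S ⊕ T) →₀ k)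
    {f' : Surface (T ⊕ U) →₀ k} (hf' : f' ∈ localRel k (T ⊕ U)) :
    compFree k S T U f f' ∈ localRel k (S ⊕ U) := by
  induction hf' using Submodule.span_induction with
  | mem f' hf' =>
    induction f using Finsupp.induction_linear with
    | zero => simp
    | add x y hx hy => rw [map_add]; exact add_mem hx hy
    | single C r =>
      rw [← mul_one r, ← smul_eq_mul, ← Finsupp.smul_single, map_smul, LinearMap.smul_apply,
        compFree_single_left]
      exact Submodule.smul_mem _ _ (Submodule.subset_span (hf'.comp_left C))
  | zero => simp
  | add x y _ _ hx hy => rw [map_add]; exact add_mem hx hy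
  | smul r x _ hx => rw [map_smul]; exact Submodule.smul_mem _ _ hx

/-- Composition of linear combinations of cobordisms modulo the local relations. -/
def compModRel (S T U : Type) [Finite T] :
    ModRel k (S ⊕ T) →ₗ[k] ModRel k (T ⊕ U) →ₗ[k] ModRel k (S ⊕ U) :=
  (localRel k (S ⊕ T)).liftQ
    { toFun := fun f => (localRel k (T ⊕ U)).mapQ (localRel k (S ⊕ U)) (compFree k S T U f)
        fun _ h => compFree_mem_right k f h
      map_add' := fun f g => by
        refine Submodule.linearMap_qext _ (LinearMap.ext fun x => ?_)
        simp
      map_smul' := fun r f => by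
        refine Submodule.linearMap_qext _ (LinearMap.ext fun x => ?_)
        simp }
    fun f hf => by
      refine LinearMap.mem_ker.2 (Submodule.linearMap_qext _ (LinearMap.ext fun x => ?_))
      exact (Submodule.Quotient.mk_eq_zero _).2 (compFree_mem_left k hf x)

@[simp]
theorem compModRel_toModRel {S T U : Type} [Finite T] (C : Surface (S ⊕ T))
    (D : Surface (T ⊕ U)) :
    compModRel k S T U (toModRel k C) (toModRel k D) = toModRel k (comp C D) := by
  have h := compFree_single_left k C (Finsupp.single D 1)
  rw [Finsupp.mapDomain_single] at h
  exact congrArg Submodule.Quotient.mk h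

theorem compModRel_assoc {S T U V : Type} [Finite T] [Finite U] (x : ModRel k (S ⊕ T))
    (y : ModRel k (T ⊕ U)) (z : ModRel k (U ⊕ V)) :
    compModRel k S U V (compModRel k S T U x y) z
      = compModRel k S T V x (compModRel k T U V y z) := by
  induction x using modRel_induction with
  | zero => simp
  | add x x' hx hx' => simp only [map_add, LinearMap.add_apply, hx, hx']
  | smul r x hx => simp only [map_smul, LinearMap.smul_apply, hx]
  | of C =>
    induction y using modRel_induction with
    | zero => simp
    | add y y' hy hy' => simp only [map_add, LinearMap.add_apply, hy, hy']
    | smul r y hy => simp only [map_smul, LinearMap.smul_apply, hy]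
    | of D =>
      induction z using modRel_induction with
      | zero => simp
      | add z z' hz hz' => simp only [map_add, hz, hz']
      | smul r z hz => simp only [map_smul, hz]
      | of F => simp only [compModRel_toModRel, comp_assoc]

end Surface

/-- The objects of the category `Cobₗ` are those of `Cob`. -/
structure CobLoc (k : Type) where
  obj : Cob

namespace CobLoc

variable (k : Type) [CommRing k]

/-- The category of `k`-linear combinations of cobordisms modulo the local relations. -/
instance : Category (CobLoc k) where
  Hom S T := Surface.ModRel k (S.obj ⊕ T.obj)
  id S := Surface.toModRel k (𝟙 S.obj : S.obj ⟶ S.obj)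
  comp {S T U} x y := Surface.compModRel k S.obj T.obj U.obj x y
  id_comp {S T} x := by
    induction x using Surface.modRel_induction with
    | zero => simp
    | add x y hx hy => rw [map_add, hx, hy]
    | smul r x hx => rw [map_smul, hx]
    | of C =>
      rw [Surface.compModRel_toModRel]
      exact congrArg _ (Surface.cyl_comp C)
  comp_id {S T} x := by
    induction x using Surface.modRel_induction with
    | zero => simp
    | add x y hx hy => rw [map_add, LinearMap.add_apply, hx, hy]
    | smul r x hx => rw [map_smul, LinearMap.smul_apply, hx]
    | of C =>
      rw [Surface.compModRel_toModRel]
      exact congrArg _ (Surface.comp_cyl C)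
  assoc x y z := Surface.compModRel_assoc k x y z

instance : Preadditive (CobLoc k) where
  homGroup S T := inferInstanceAs (AddCommGroup (Surface.ModRel k (S.obj ⊕ T.obj)))
  add_comp S T U x x' y := LinearMap.map_add₂ (Surface.compModRel k S.obj T.obj U.obj) x x' y
  comp_add S T U x y y' := LinearMap.map_add (Surface.compModRel k S.obj T.obj U.obj x) y y'

instance : Linear k (CobLoc k) where
  homModule S T := inferInstanceAs (Module k (Surface.ModRel k (S.obj ⊕ T.obj)))
  smul_comp S T U r x y := LinearMap.map_smul₂ (Surface.compModRel k S.obj T.obj U.obj) r x y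
  comp_smul S T U x r y := LinearMap.map_smul (Surface.compModRel k S.obj T.obj U.obj x) r y

/-- The functor that sends a cobordism to its class modulo the local relations. -/
def fromCob : Cob ⥤ CobLoc k where
  obj S := ⟨S⟩
  map C := Surface.toModRel k C
  map_id _ := rfl
  map_comp C D := (Surface.compModRel_toModRel k C D).symm

variable {k}

/-- The tautological functor `Mor(O, -)`: it sends `O'` to the group of morphisms from `O` to `O'`
and acts on morphisms by composition. Given an endomorphism `x` of `O`, the values of the functor
are modules over the polynomial ring in one variable over `k`, where the variable acts by
precomposition with `x`. -/
def tautological (O : CobLoc k) (x : End O) : CobLoc k ⥤ ModuleCat.{0} (Polynomial k) :=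
  preadditiveCoyonedaObj O ⋙
    ModuleCat.restrictScalars (Polynomial.aeval (R := k) (MulOpposite.op x)).toRingHom

variable (k)

/-- The special 1-handle operator on the circle: the cylinder of genus one. Precomposition with it
adds a handle to the component that contains the source circle. -/
def handle : End ((fromCob k).obj Cob.circle) :=
  (fromCob k).map (Cob.connected Cob.circle Cob.circle 1)

/-- The 2-handle operator on the empty object, in the genus 3 presentation: disjoint union with one
half of the closed surface of genus 3. -/
def twoHandle : End ((fromCob ℚ).obj Cob.empty) :=
  (1 / 2 : ℚ) • (fromCob ℚ).map (Cob.connected Cob.empty Cob.empty 3)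

/-- The renormalized 2-handle operator: a quarter of the 2-handle operator. -/
def renormTwoHandle : End ((fromCob ℚ).obj Cob.empty) := (1 / 4 : ℚ) • twoHandle

end CobLoc

/-! ### Frobenius algebras and topological quantum field theories -/

/-- A Frobenius algebra structure on the commutative `R`-algebra `A`: a coalgebra structure whose
comultiplication is a map of `A`-bimodules. -/
structure FrobeniusStructure (R A : Type) [CommRing R] [CommRing A] [Algebra R A] extends
    Coalgebra R A where
  comul_mul_left (a b : A) : comul (a * b) = (a ⊗ₜ[R] 1) * comul b
  comul_mul_right (a b : A) : comul (a * b) = comul a * (1 ⊗ₜ[R] b)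
  comul_comm (a : A) : TensorProduct.comm R A A (comul a) = comul a

/-- A two-dimensional topological quantum field theory over `R` with Frobenius algebra `A`: a
functor from cobordisms to `R`-modules that maps disjoint unions to tensor products, whose value
on the circle is `A`, and whose values on the elementary cobordisms are the structure maps
of `A`. -/
structure TQFT {R A : Type} [CommRing R] [CommRing A] [Algebra R A]
    (V : FrobeniusStructure R A) where
  /-- The underlying functor. -/
  functor : Cob ⥤ ModuleCat.{0} R
  /-- The value on a union of circles is the tensor product of one copy of `A` for each circle. -/
  equiv (S : Cob) : functor.obj S ≃ₗ[R] ⨂[R] _ : S, A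
  /-- Cylinders permute the tensor factors. -/
  map_cyl {S T : Cob} (e : S ≃ T) (x : S → A) :
    equiv T (functor.map (Cob.cyl e) ((equiv S).symm (PiTensorProduct.tprod R x)))
      = PiTensorProduct.tprod R (x ∘ e.symm)
  /-- Disjoint unions of cobordisms are mapped to tensor products of linear maps. -/
  map_union {S T S' T' : Cob} (C : S ⟶ T) (D : S' ⟶ T')
    (x : functor.obj S) (y : functor.obj S') :
    equiv (T.union T') (functor.map (Cob.unionHom C D)
        ((equiv (S.union S')).symm (PiTensorProduct.tmulEquiv R A (equiv S x ⊗ₜ[R] equiv S' y))))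
      = PiTensorProduct.tmulEquiv R A
          (equiv T (functor.map C x) ⊗ₜ[R] equiv T' (functor.map D y))
  /-- The disc from the empty object to the circle is the unit of `A`. -/
  map_unit (x : Cob.empty → A) :
    equiv Cob.circle (functor.map (Cob.connected Cob.empty Cob.circle 0)
        ((equiv Cob.empty).symm (PiTensorProduct.tprod R x)))
      = PiTensorProduct.tprod R fun _ => 1
  /-- The disc from the circle to the empty object is the counit of `A`. -/
  map_counit (x : Cob.circle → A) (y : Cob.empty → A) :
    equiv Cob.empty (functor.map (Cob.connected Cob.circle Cob.empty 0)
        ((equiv Cob.circle).symm (PiTensorProduct.tprod R x)))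
      = V.counit (x ()) • PiTensorProduct.tprod R y
  /-- The pair of pants from two circles to one is the multiplication of `A`. -/
  map_mul (x : Cob.circle.union Cob.circle → A) :
    equiv Cob.circle (functor.map (Cob.connected (Cob.circle.union Cob.circle) Cob.circle 0)
        ((equiv (Cob.circle.union Cob.circle)).symm (PiTensorProduct.tprod R x)))
      = PiTensorProduct.tprod R fun _ => x (Sum.inl ()) * x (Sum.inr ())
  /-- The pair of pants from one circle to two is the comultiplication of `A`. -/
  map_comul (x : Cob.circle → A) :
    equiv (Cob.circle.union Cob.circle)
        (functor.map (Cob.connected Cob.circle (Cob.circle.union Cob.circle) 0)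
          ((equiv Cob.circle).symm (PiTensorProduct.tprod R x)))
      = PiTensorProduct.tmulEquiv R A
          (TensorProduct.map
            (PiTensorProduct.subsingletonEquiv (R := R) (s := fun _ : Cob.circle => A)
              ()).symm.toLinearMap
            (PiTensorProduct.subsingletonEquiv (R := R) (s := fun _ : Cob.circle => A)
              ()).symm.toLinearMap
            (V.comul (x ())))

/-! ### The rank two Frobenius algebras -/

namespace RankTwo

open Polynomial

variable {R : Type} [CommRing R] (h t : R)

/-- The polynomial `X² - h X - t`. -/
def poly : R[X] := X ^ 2 - C h * X - C t

theorem poly_eq : poly h t = X ^ 2 + (C (-h) * X + C (-t)) := by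
  simp [poly]; ring

theorem monic_poly : (poly h t).Monic := by
  rw [poly_eq]
  exact monic_X_pow_add (lt_of_le_of_lt degree_linear_le (by norm_num))

theorem natDegree_poly [Nontrivial R] : (poly h t).natDegree = 2 := by
  rw [poly_eq]
  compute_degree!

/-- The algebra `A = R[X] / (X² - h X - t)`. -/
abbrev Alg : Type := AdjoinRoot (poly h t)

/-- The class of `X` in `A`, also denoted `v₋`. -/
abbrev x : Alg h t := AdjoinRoot.root (poly h t)

theorem x_mul_x : x h t * x h t = h • x h t + t • (1 : Alg h t) := by
  have this : eval₂ (AdjoinRoot.of (poly h t)) (x h t) (X ^ 2 - C h * X - C t) = 0 :=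
    AdjoinRoot.eval₂_root (poly h t)
  simp only [eval₂_sub, eval₂_pow, eval₂_X, eval₂_mul, eval₂_C] at this
  rw [Algebra.smul_def, Algebra.smul_def, mul_one, AdjoinRoot.algebraMap_eq]
  linear_combination this

variable [Nontrivial R]

/-- The basis `v₊ = 1`, `v₋ = X` of `A` over `R`. -/
def basis : Module.Basis (Fin 2) R (Alg h t) :=
  (AdjoinRoot.powerBasis' (monic_poly h t)).basis.reindex (finCongr (natDegree_poly h t))

@[simp] theorem basis_zero : basis h t 0 = 1 := by
  simp [basis, finCongr]

@[simp] theorem basis_one : basis h t 1 = x h t := by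
  simp [basis, finCongr]

/-- The comultiplication `1 ↦ 1 ⊗ X + X ⊗ 1 - h 1 ⊗ 1`, `X ↦ X ⊗ X + t 1 ⊗ 1`. -/
def comul : Alg h t →ₗ[R] Alg h t ⊗[R] Alg h t :=
  (basis h t).constr R
    ![1 ⊗ₜ x h t + x h t ⊗ₜ 1 - h • (1 ⊗ₜ 1), x h t ⊗ₜ x h t + t • (1 ⊗ₜ 1)]

/-- The counit `1 ↦ 0`, `X ↦ 1`. -/
def counit : Alg h t →ₗ[R] R := (basis h t).constr R ![0, 1]

theorem comul_one : comul h t 1 = 1 ⊗ₜ x h t + x h t ⊗ₜ 1 - h • (1 ⊗ₜ 1) := by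
  rw [← basis_zero, comul, Module.Basis.constr_basis]; simp

theorem comul_x : comul h t (x h t) = x h t ⊗ₜ x h t + t • (1 ⊗ₜ 1) := by
  rw [← basis_one, comul, Module.Basis.constr_basis]; simp

theorem counit_one : counit h t 1 = 0 := by
  rw [← basis_zero, counit, Module.Basis.constr_basis]; simp

theorem counit_x : counit h t (x h t) = 1 := by
  rw [← basis_one, counit, Module.Basis.constr_basis]; simp

theorem hom_ext {M : Type} [AddCommGroup M] [Module R M] {φ ψ : Alg h t →ₗ[R] M}
    (h1 : φ 1 = ψ 1) (hx : φ (x h t) = ψ (x h t)) : φ = ψ := by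
  refine (basis h t).ext fun i => ?_
  fin_cases i
  · simpa using h1
  · simpa using hx

theorem comul_eq (a : Alg h t) : comul h t a = (a ⊗ₜ 1) * comul h t 1 := by
  have : comul h t = (LinearMap.mulRight R (comul h t 1)).comp
      (Algebra.TensorProduct.includeLeft (R := R) (S := R) (A := Alg h t)
        (B := Alg h t)).toLinearMap := by
    refine hom_ext h t ?_ ?_
    · simp [← Algebra.TensorProduct.one_def]
    · simp [comul_one, comul_x, mul_add, mul_sub, x_mul_x, TensorProduct.add_tmul,
        ← TensorProduct.smul_tmul']
      abel
  exact LinearMap.congr_fun this a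

theorem comul_comm (a : Alg h t) :
    TensorProduct.comm R _ _ (comul h t a) = comul h t a := by
  have : (TensorProduct.comm R _ _).toLinearMap.comp (comul h t) = comul h t := by
    refine hom_ext h t ?_ ?_
    · simp [comul_one, add_comm]
    · simp [comul_x]
  exact LinearMap.congr_fun this a

/-- The Frobenius algebra `A = R[X] / (X² - h X - t)`. -/
def frobenius : FrobeniusStructure R (Alg h t) where
  comul := comul h t
  counit := counit h t
  coassoc := by
    refine hom_ext h t ?_ ?_
    · simp [comul_one, comul_x, TensorProduct.tmul_add, TensorProduct.add_tmul,
        TensorProduct.tmul_sub, TensorProduct.sub_tmul, ← TensorProduct.smul_tmul']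
      module
    · simp [comul_one, comul_x, TensorProduct.tmul_add, TensorProduct.add_tmul,
        TensorProduct.tmul_sub, TensorProduct.sub_tmul, ← TensorProduct.smul_tmul']
      module
  rTensor_counit_comp_comul := by
    refine hom_ext h t ?_ ?_
    · simp [comul_one, counit_one, counit_x]
    · simp [comul_x, counit_one, counit_x]
  lTensor_counit_comp_comul := by
    refine hom_ext h t ?_ ?_
    · simp [comul_one, counit_one, counit_x]
    · simp [comul_x, counit_one, counit_x]
  comul_mul_left a b := by
    rw [comul_eq, comul_eq h t b, ← mul_assoc]
    simp
  comul_mul_right a b := by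
    have hc : ∀ y z : Alg h t ⊗[R] Alg h t, TensorProduct.comm R _ _ (y * z)
        = TensorProduct.comm R _ _ y * TensorProduct.comm R _ _ z :=
      map_mul (Algebra.TensorProduct.comm R (Alg h t) (Alg h t))
    have hl : comul h t (b * a) = (b ⊗ₜ 1) * comul h t a := by
      rw [comul_eq, comul_eq h t a, ← mul_assoc]
      simp
    rw [mul_comm a b, ← comul_comm, hl, hc, comul_comm, TensorProduct.comm_tmul, mul_comm]
  comul_comm := comul_comm h t

end RankTwo

end

/-! Let `L` be a field containing `R` in which `X² - hX - t` has two distinct roots. After extension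
of scalars to `L` the algebra `A` splits into two copies of `L`, and its TQFT becomes a state sum:
colour every component by a root and give it the weight `θ ^ (genus - 1)`, where `θ` is the coloured
root minus the other one. With the colours of the boundary circles prescribed, this yields matrices
that multiply under gluing (`stateSum_comp`, `transfer_comp`). The local relations hold because a
tube between components coloured `a` and `b` contributes `δ_ab θ_a = root a + root b - h`. This is a
sum of a term for each end and a constant, which is all that 4TU needs. A sphere contributes `θ⁻¹ +
(-θ)⁻¹ = 0` and a torus contributes `2` (`linearCombination_stateSum_eq_zero`).

Fix an object `O`, an endomorphism `x` of it, and a function `v` on the colourings of `O` that is an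
eigenvector of `x` with the polynomial variable as eigenvalue. Applying state sums to `v` is then a
`k[X]`-linear map from `Mor(O, S)` to the functions on colourings of `S`. The tensor power of `A`
indexed by `S` embeds into the same functions by evaluation at the roots (`evalTensor_injective`).
If elements of `Mor(O, S)` are mapped to the evaluated tensors of the basis `1, X`, they are
linearly independent. If they also generate, they form a basis, and `Mor(O, S)` is identified with
the tensor power, compatibly with all cobordisms (`exists_tqft`).

Generation is a consequence of the local relations. With a special circle on the component `*`, 4TU
reads `tube(a,b) = tube(a,*) + tube(b,*) - tube(*,*)`, so every tube may be made to end at `*`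
(`toModRel_mem_of_stars`). Without a special circle but with `2` invertible, `2 tube(a,b)` is a
handle at `a` plus a handle at `b`, and two handles on one component equal half a disjoint surface
of genus `3` (`toModRel_mem_of_discs`). -/

noncomputable section

/-! ### The state sum of a surface -/

namespace Surface

section StateSum

variable {L : Type} [Field L] (θ : Bool → Lˣ)

/-- Grouping the factors by colour brings the exponents into the form of `tubeGenus_sum`, with an
indicator function of a colour as test function. -/
theorem prod_zpow_bool {ι : Type} [Fintype ι] (c : ι → Bool) (n : ι → ℤ) :
    ∏ i, θ (c i) ^ n i
      = ∏ b, θ b ^ ∑ i, (if c i = b then 1 else 0) * n i := by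
  classical
  have h : ∀ (b : Bool) (f : ι → ℤ), θ b ^ ∑ i, f i = ∏ i, θ b ^ f i := by
    intro b f
    exact map_prod (zpowersHom Lˣ (θ b)) (fun i => Multiplicative.ofAdd (f i)) Finset.univ
  simp_rw [h]
  rw [Finset.prod_comm]
  refine Finset.prod_congr rfl fun i _ => ?_
  rw [Finset.prod_eq_single (c i)]
  · simp
  · intro b _ hb
    simp [hb.symm]
  · simp

open Classical in
/-- The two-coloured state sum of a surface, with colours `σ` prescribed on the boundary: the sum,
over all colourings of the components that extend `σ`, of the product of the weights
`θ c ^ (genus - 1)` of the components. -/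
def stateSum {B : Type} (C : Surface B) (σ : B → Bool) : L :=
  Quotient.lift (s := surfaceSetoid B)
    (fun x => ∑ c : Fin x.1 → Bool,
      if c ∘ x.2.2 = σ then ((∏ k, θ (c k) ^ ((x.2.1 k : ℤ) - 1) : Lˣ) : L) else 0)
    (by
      rintro x y ⟨e, h1, h2⟩
      refine Fintype.sum_equiv (e.arrowCongr (Equiv.refl Bool)) _ _ fun c => ?_
      have hc : ((e.arrowCongr (Equiv.refl Bool)) c) ∘ y.2.2 = c ∘ x.2.2 := by
        funext b; simp [h2]
      rw [hc, ← e.prod_comp]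
      simp [h1]) C

open Classical in
theorem stateSum_of {B K : Type} [Fintype K] [Fintype (K → Bool)] (g : K → ℕ) (p : B → K)
    (σ : B → Bool) :
    stateSum θ (of g p) σ
      = ∑ c : K → Bool,
          if c ∘ p = σ then ((∏ k, θ (c k) ^ ((g k : ℤ) - 1) : Lˣ) : L) else 0 := by
  symm
  refine Fintype.sum_equiv ((Finite.equivFin K).arrowCongr (Equiv.refl Bool)) _ _ fun c => ?_
  have hc : (((Finite.equivFin K).arrowCongr (Equiv.refl Bool)) c) ∘ Finite.equivFin K ∘ p
      = c ∘ p := by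
    funext b; simp
  simp only [hc]
  rw [← (Finite.equivFin K).prod_comp]
  simp

open Classical in
-- A tube forces its two ends to have the same colour. It contributes one factor `θ`, since `genus -
-- 1` is additive over components and increases by one with each tube.
theorem stateSum_tubes {B K E : Type} [Fintype K] [Fintype E] [Fintype (K → Bool)] (g : K → ℕ)
    (p : B → K) (s t : E → K) (σ : B → Bool) :
    stateSum θ (tubes g p s t) σ
      = ∑ c : K → Bool, if c ∘ p = σ ∧ c ∘ s = c ∘ t then
          ((∏ k, θ (c k) ^ ((g k : ℤ) - 1) : Lˣ) : L) * ((∏ e, θ (c (s e)) : Lˣ) : L) else 0 := by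
  have := Fintype.ofFinite (TubeComp s t)
  rw [tubes, stateSum_of]
  -- Colourings of the new components are the colourings of the old ones that agree at the two ends
  -- of every tube.
  refine Finset.sum_bij_ne_zero (fun c _ _ => c ∘ Quot.mk _) (fun _ _ _ => Finset.mem_univ _)
    ?_ ?_ ?_
  · intro c _ _ c' _ _ h
    funext q
    obtain ⟨k, rfl⟩ := Quot.exists_rep q
    exact congrFun h k
  · intro c _ hc
    have hst : c ∘ s = c ∘ t := by
      by_contra h
      simp [h] at hc
    have hp : c ∘ p = σ := by
      by_contra h
      simp [h] at hc
    refine ⟨Quot.lift c ?_, Finset.mem_univ _, ?_, rfl⟩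
    · rintro _ _ ⟨e, rfl, rfl⟩
      exact congrFun hst e
    · rw [if_pos (by rw [← hp]; rfl)]
      exact Units.ne_zero _
  · intro c _ _
    have hst : (c ∘ Quot.mk _) ∘ s = (c ∘ Quot.mk _) ∘ t := by
      funext e
      exact congrArg c (Quot.sound ⟨e, rfl, rfl⟩)
    simp only [hst, and_true]
    refine if_congr Iff.rfl ?_ rfl
    rw [← Units.val_mul]
    congr 1
    have h1 : ∏ e, θ ((c ∘ Quot.mk _) (s e)) = ∏ e, θ ((c ∘ Quot.mk _) (s e)) ^ (1 : ℤ) := by simp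
    rw [h1, prod_zpow_bool θ c, prod_zpow_bool θ fun k => (c ∘ Quot.mk _) k,
      prod_zpow_bool θ fun e => (c ∘ Quot.mk _) (s e), ← Finset.prod_mul_distrib]
    refine Finset.prod_congr rfl fun b _ => ?_
    rw [← zpow_add, tubeGenus_sum]
    simp

open Classical in
theorem stateSum_addTube {B K : Type} [Fintype K] [Fintype (K → Bool)] (g : K → ℕ) (p : B → K)
    (i j : K) (σ : B → Bool) :
    stateSum θ (addTube g p i j) σ
      = ∑ c : K → Bool, (if c ∘ p = σ then ((∏ k, θ (c k) ^ ((g k : ℤ) - 1) : Lˣ) : L) else 0)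
          * if c i = c j then (θ (c i) : L) else 0 := by
  rw [addTube, stateSum_tubes]
  refine Finset.sum_congr rfl fun c _ => ?_
  by_cases h : c i = c j <;> by_cases h' : c ∘ p = σ <;>
    simp [funext_iff, h]

theorem sum_sumArrow {K K' : Type} [Fintype (K → Bool)] [Fintype (K' → Bool)]
    [Fintype (K ⊕ K' → Bool)] {M : Type} [AddCommMonoid M] (f : (K ⊕ K' → Bool) → M) :
    ∑ c, f c = ∑ c : K → Bool, ∑ c' : K' → Bool, f (Sum.elim c c') := by
  rw [← (Equiv.sumArrowEquivProdArrow K K' Bool).symm.sum_comp, Fintype.sum_prod_type]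
  rfl

theorem stateSum_addClosed {B K : Type} [Finite K] (g : K → ℕ) (p : B → K) (n : ℕ)
    (σ : B → Bool) :
    stateSum θ (addClosed g p n) σ
      = stateSum θ (of g p) σ * ∑ b, ((θ b ^ ((n : ℤ) - 1) : Lˣ) : L) := by
  classical
  have := Fintype.ofFinite K
  rw [addClosed, stateSum_of, stateSum_of, sum_sumArrow, Finset.sum_mul]
  refine Finset.sum_congr rfl fun c _ => ?_
  rw [Finset.mul_sum]
  refine (Fintype.sum_equiv (Equiv.funUnique Unit Bool).symm _ _ fun b => ?_).symm
  have : Sum.elim c ((Equiv.funUnique Unit Bool).symm b) ∘ (fun b => Sum.inl (p b)) = c ∘ p := rfl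
  simp only [this]
  by_cases h : c ∘ p = σ <;> simp [h]

theorem disj_of {S T S' T' K K' : Type} [Finite K] [Finite K'] (g : K → ℕ) (p : S ⊕ T → K)
    (g' : K' → ℕ) (p' : S' ⊕ T' → K') :
    disj (of g p) (of g' p')
      = of (Sum.elim g g') (Sum.elim (Sum.map (p ∘ Sum.inl) (p' ∘ Sum.inl))
          (Sum.map (p ∘ Sum.inr) (p' ∘ Sum.inr))) := by
  refine (of_eq_of (Equiv.sumCongr (Finite.equivFin K) (Finite.equivFin K')) ?_ ?_).symm
  · rintro (k | k) <;> simp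
  · rintro ((b | b) | (b | b)) <;> simp

theorem stateSum_disj {S T S' T' : Type} (C : Surface (S ⊕ T)) (D : Surface (S' ⊕ T'))
    (σ : S → Bool) (σ' : S' → Bool) (τ : T → Bool) (τ' : T' → Bool) :
    stateSum θ (disj C D) (Sum.elim (Sum.elim σ σ') (Sum.elim τ τ'))
      = stateSum θ C (Sum.elim σ τ) * stateSum θ D (Sum.elim σ' τ') := by
  classical
  obtain ⟨n, g, p, rfl⟩ := C.exists_of
  obtain ⟨n', g', p', rfl⟩ := D.exists_of
  rw [disj_of, stateSum_of, stateSum_of, stateSum_of, sum_sumArrow, Finset.sum_mul_sum]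
  refine Finset.sum_congr rfl fun c _ => Finset.sum_congr rfl fun c' _ => ?_
  have : Sum.elim c c' ∘ (Sum.elim (Sum.map (p ∘ Sum.inl) (p' ∘ Sum.inl))
        (Sum.map (p ∘ Sum.inr) (p' ∘ Sum.inr))) = Sum.elim (Sum.elim σ σ') (Sum.elim τ τ')
      ↔ c ∘ p = Sum.elim σ τ ∧ c' ∘ p' = Sum.elim σ' τ' := by
    simp only [funext_iff, Sum.forall, Function.comp, Sum.elim_inl, Sum.elim_inr, Sum.map_inl,
      Sum.map_inr]
    tauto
  simp only [this]
  by_cases h1 : c ∘ p = Sum.elim σ τ <;> by_cases h2 : c' ∘ p' = Sum.elim σ' τ' <;>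
    simp [h1, h2]

/-- Gluing along a circle is attaching a tube, so each glued circle contributes the factor `θ` of
its colour. -/
theorem stateSum_comp {S T U : Type} [Fintype T] [DecidableEq T] (C : Surface (S ⊕ T))
    (D : Surface (T ⊕ U)) (σ : S → Bool) (υ : U → Bool) :
    stateSum θ (comp C D) (Sum.elim σ υ)
      = ∑ τ : T → Bool, stateSum θ C (Sum.elim σ τ) * ((∏ t, θ (τ t) : Lˣ) : L)
          * stateSum θ D (Sum.elim τ υ) := by
  classical
  obtain ⟨n, g, p, rfl⟩ := C.exists_of
  obtain ⟨n', g', p', rfl⟩ := D.exists_of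
  rw [comp_of, stateSum_tubes, sum_sumArrow]
  simp_rw [stateSum_of, Finset.sum_mul, Finset.mul_sum]
  rw [Finset.sum_comm (s := Finset.univ (α := T → Bool))]
  refine Finset.sum_congr rfl fun c _ => ?_
  rw [Finset.sum_comm]
  refine Finset.sum_congr rfl fun c' _ => ?_
  -- The colours of the glued circles are determined by the colouring `c` of the components of `C`.
  rw [Finset.sum_eq_single (fun t => c (p (Sum.inr t)))]
  · have : (Sum.elim c c' ∘ Sum.map (p ∘ Sum.inl) (p' ∘ Sum.inr) = Sum.elim σ υ ∧
        (Sum.elim c c' ∘ fun b : T => Sum.inl (p (Sum.inr b)))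
          = Sum.elim c c' ∘ fun b : T => Sum.inr (p' (Sum.inl b)))
        ↔ c ∘ p = Sum.elim σ (fun t => c (p (Sum.inr t)))
          ∧ c' ∘ p' = Sum.elim (fun t => c (p (Sum.inr t))) υ := by
      simp only [funext_iff, Sum.forall, Function.comp, Sum.elim_inl, Sum.elim_inr, Sum.map_inl,
        Sum.map_inr]
      constructor
      · rintro ⟨⟨h1, h2⟩, h3⟩
        exact ⟨⟨h1, fun _ => trivial⟩, fun t => (h3 t).symm, h2⟩
      · rintro ⟨⟨h1, _⟩, h3, h2⟩
        exact ⟨⟨h1, h2⟩, fun t => (h3 t).symm⟩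
    simp only [this]
    by_cases h1 : c ∘ p = Sum.elim σ (fun t => c (p (Sum.inr t))) <;>
      by_cases h2 : c' ∘ p' = Sum.elim (fun t => c (p (Sum.inr t))) υ <;>
      simp [h1, h2]
    ring
  · intro τ _ hτ
    rw [if_neg, zero_mul, zero_mul]
    intro h
    exact hτ (funext fun t => (congrFun h (Sum.inr t)).symm)
  · simp

open Classical in
theorem stateSum_connected {B : Type} (n : ℕ) (σ : B → Bool) :
    stateSum θ (connected B n) σ
      = ∑ b, if (fun _ => b) = σ then ((θ b ^ ((n : ℤ) - 1) : Lˣ) : L) else 0 := by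
  rw [connected, stateSum_of θ (K := Unit)]
  refine (Fintype.sum_equiv (Equiv.funUnique Unit Bool).symm _ _ fun b => ?_).symm
  refine if_congr Iff.rfl ?_ rfl
  simp

open Classical in
theorem stateSum_cyl {S T : Type} [Fintype S] (e : S ≃ T) (σ : S → Bool) (τ : T → Bool) :
    stateSum θ (cyl e) (Sum.elim σ τ)
      = if σ = τ ∘ e then ((∏ s, θ (σ s) : Lˣ) : L)⁻¹ else 0 := by
  rw [cyl, stateSum_of, Finset.sum_eq_single σ]
  · have : σ ∘ Sum.elim id e.symm = Sum.elim σ τ ↔ σ = τ ∘ e := by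
      simp only [funext_iff, Sum.forall, Function.comp, Sum.elim_inl, Sum.elim_inr, id]
      constructor
      · rintro ⟨_, h⟩ s; rw [← h, e.symm_apply_apply]
      · intro h; exact ⟨fun _ => trivial, fun t => by rw [h, e.apply_symm_apply]⟩
    simp [this]
  · intro c _ hc
    rw [if_neg]
    intro h
    exact hc (funext fun s => congrFun h (Sum.inl s))
  · simp

end StateSum

end Surface

/-! ### Splitting the polynomial over a field -/

/-- A field extension in which `X² - h X - t` has two distinct roots. The difference of a root and
the other one is recorded as a unit. -/
structure Splitting {R : Type} (L : Type) [CommRing R] [Field L] [Algebra R L] (h t : R) where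
  root : Bool → L
  diff : Bool → Lˣ
  root_mul_root (b : Bool) :
    root b * root b = algebraMap R L h * root b + algebraMap R L t
  root_add_root (a b : Bool) :
    root a + root b - algebraMap R L h = if a = b then (diff a : L) else 0

namespace Splitting

variable {R L : Type} [CommRing R] [Field L] [Algebra R L] {h t : R} (s : Splitting L h t)

theorem diff_eq (b : Bool) : (s.diff b : L) = s.root b - s.root (!b) := by
  have h1 := s.root_add_root b b
  have h2 := s.root_add_root b (!b)
  rw [if_pos rfl] at h1
  rw [if_neg (by simp)] at h2
  linear_combination -h1 + h2

theorem diff_not (b : Bool) : (s.diff (!b) : L) = -s.diff b := by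
  rw [diff_eq, diff_eq, Bool.not_not]; ring

/-- The splitting given by two distinct roots. -/
def ofRoots (a b : L) (hab : a ≠ b) (hh : a + b = algebraMap R L h)
    (ht : a * b = -algebraMap R L t) : Splitting L h t where
  root i := if i then a else b
  diff i := if i then Units.mk0 (a - b) (sub_ne_zero.2 hab)
    else Units.mk0 (b - a) (sub_ne_zero.2 hab.symm)
  root_mul_root i := by
    rw [← hh]
    cases i <;> (simp only [Bool.false_eq_true, if_false, if_true]; linear_combination -ht)
  root_add_root i j := by
    cases i <;> cases j <;> simp [← hh]
    ring

end Splitting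

/-! ### Local relations for state sums, and the transfer operators -/

namespace Surface

variable {R L : Type} [CommRing R] [Field L] [Algebra R L] {h t : R} (s : Splitting L h t)
variable {k : Type} [CommRing k] [Algebra k L]

theorem linearCombination_stateSum_eq_zero {B : Type} {f : Surface B →₀ k}
    (hf : f ∈ localRel k B) (σ : B → Bool) :
    Finsupp.linearCombination k (fun C => stateSum s.diff C σ) f = 0 := by
  classical
  induction hf using Submodule.span_induction with
  | zero => simp
  | add x y _ _ hx hy => rw [map_add, hx, hy, add_zero]
  | smul a x _ hx => rw [map_smul, hx, smul_zero]
  | mem f hf =>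
    cases hf with
    | fourTu g p D =>
      have := Fintype.ofFinite ‹Type›
      -- Once each tube factor is written as `root a + root b - h`, the four terms cancel for every
      -- single colouring.
      simp only [map_sub, map_add, Finsupp.linearCombination_single, one_smul, stateSum_addTube,
        ← s.root_add_root, ← Finset.sum_add_distrib, ← Finset.sum_sub_distrib]
      refine Finset.sum_eq_zero fun c _ => ?_
      ring
    | sphere g p =>
      -- A component of genus `0` has weight `θ⁻¹`, and the two values of `θ` are opposite.
      have h1 : (s.diff false : L) = -s.diff true := s.diff_not true
      simp [stateSum_addClosed, h1, inv_neg]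
    | torus g p =>
      simp only [map_sub, Finsupp.linearCombination_single, stateSum_addClosed]
      simp [Algebra.smul_def, show algebraMap k L 2 = 2 from map_ofNat _ 2]
      ring

section Transfer

variable {S T U : Type} [Finite S] [Finite T] [Finite U]

open Classical in
/-- The matrix of state sums of a cobordism, as an operator between spaces of functions of the
colourings of the ends. -/
def transfer (C : Surface (S ⊕ T)) : ((S → Bool) → L) →ₗ[L] ((T → Bool) → L) :=
  letI := Fintype.ofFinite S
  letI := Fintype.ofFinite T
  { toFun := fun f τ =>
      (∑ σ, f σ * stateSum s.diff C (Sum.elim σ τ)) * ((∏ b, s.diff (τ b) : Lˣ) : L)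
    map_add' := fun f f' => by
      funext τ
      simp only [Pi.add_apply, add_mul, Finset.sum_add_distrib]
    map_smul' := fun a f => by
      funext τ
      simp only [Pi.smul_apply, smul_eq_mul, RingHom.id_apply, mul_assoc, ← Finset.mul_sum] }

theorem transfer_apply [Fintype (S → Bool)] [Fintype T] (C : Surface (S ⊕ T))
    (f : (S → Bool) → L) (τ : T → Bool) :
    transfer s C f τ
      = (∑ σ, f σ * stateSum s.diff C (Sum.elim σ τ)) * ((∏ b, s.diff (τ b) : Lˣ) : L) := by
  unfold transfer
  dsimp only [LinearMap.coe_mk, AddHom.coe_mk]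
  congr!

/-- The weights of the glued circles in `stateSum_comp` are exactly the target weights built into
`transfer`; this is the reason for that normalization. -/
theorem transfer_comp (C : Surface (S ⊕ T)) (D : Surface (T ⊕ U)) (f : (S → Bool) → L) :
    transfer s (comp C D) f = transfer s D (transfer s C f) := by
  classical
  have := Fintype.ofFinite S
  have := Fintype.ofFinite T
  have := Fintype.ofFinite U
  funext υ
  simp_rw [transfer_apply, stateSum_comp, Finset.mul_sum, Finset.sum_mul]
  rw [Finset.sum_comm]
  refine Finset.sum_congr rfl fun τ _ => Finset.sum_congr rfl fun σ _ => ?_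
  ring

variable (k) in
/-- The value on a vector `v` of the operators of state sums, extended to linear combinations of
cobordisms modulo the local relations. -/
def transferAt (v : (S → Bool) → L) : ModRel k (S ⊕ T) →ₗ[k] ((T → Bool) → L) :=
  (localRel k (S ⊕ T)).liftQ (Finsupp.linearCombination k fun C => transfer s C v) fun f hf => by
    classical
    have := Fintype.ofFinite S
    have := Fintype.ofFinite T
    rw [LinearMap.mem_ker]
    funext τ
    have h1 : Finsupp.linearCombination k (fun C => transfer s C v) f τ
        = (∑ σ, v σ * Finsupp.linearCombination k
            (fun C => stateSum s.diff C (Sum.elim σ τ)) f) * ((∏ b, s.diff (τ b) : Lˣ) : L) := by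
      clear hf
      induction f using Finsupp.induction_linear with
      | zero => simp
      | add f f' hf hf' =>
        simp only [map_add, Pi.add_apply, hf, hf', mul_add, Finset.sum_add_distrib, add_mul]
      | single C a =>
        simp only [Finsupp.linearCombination_single, Pi.smul_apply, transfer_apply,
          mul_smul_comm, ← Finset.smul_sum, smul_mul_assoc]
    rw [h1]
    simp [linearCombination_stateSum_eq_zero s hf]

@[simp]
theorem transferAt_toModRel (v : (S → Bool) → L) (C : Surface (S ⊕ T)) :
    transferAt s k v (toModRel k C) = transfer s C v := by
  simp [transferAt, toModRel]

theorem transferAt_smul (a : L) (v : (S → Bool) → L) (x : ModRel k (S ⊕ T)) :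
    transferAt s k (a • v) x = a • transferAt s k v x := by
  induction x using modRel_induction with
  | zero => simp
  | add x y hx hy => simp only [map_add, hx, hy, smul_add]
  | smul b x hx => rw [map_smul, map_smul, hx, smul_comm]
  | of C => simp

theorem transferAt_comp (v : (S → Bool) → L) (x : ModRel k (S ⊕ T)) (D : Surface (T ⊕ U)) :
    transferAt s k v (compModRel k S T U x (toModRel k D))
      = transfer s D (transferAt s k v x) := by
  induction x using modRel_induction with
  | zero => simp
  | add x y hx hy => simp only [map_add, LinearMap.add_apply, hx, hy]
  | smul b x hx =>
    rw [map_smul, LinearMap.smul_apply, map_smul, map_smul, hx,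
      LinearMap.map_smul_of_tower]
  | of C => simp [transfer_comp]

theorem transferAt_comp_left (v : (S → Bool) → L) (C : Surface (S ⊕ T))
    (x : ModRel k (T ⊕ U)) :
    transferAt s k v (compModRel k S T U (toModRel k C) x)
      = transferAt s k (transfer s C v) x := by
  induction x using modRel_induction with
  | zero => simp
  | add x y hx hy => simp only [map_add, hx, hy]
  | smul b x hx => rw [map_smul, map_smul, map_smul, hx]
  | of D => simp [transfer_comp]

end Transfer

end Surface

/-! ### Transfer operators of cylinders, disjoint unions and connected cobordisms -/

namespace Surface

variable {R L : Type} [CommRing R] [Field L] [Algebra R L] {h t : R} (s : Splitting L h t)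

theorem transfer_cyl {S T : Type} [Finite S] [Finite T] (e : S ≃ T) (f : (S → Bool) → L) :
    transfer s (cyl e) f = fun τ => f (τ ∘ e) := by
  classical
  have := Fintype.ofFinite S
  have := Fintype.ofFinite T
  funext τ
  simp only [transfer_apply, stateSum_cyl]
  rw [Finset.sum_eq_single (τ ∘ e)]
  · rw [if_pos rfl, ← e.prod_comp, mul_assoc]
    simp [Finset.prod_ne_zero_iff]
  · intro σ _ hσ
    rw [if_neg hσ, mul_zero]
  · simp

theorem transfer_disj {S T S' T' : Type} [Finite S] [Finite T] [Finite S'] [Finite T']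
    (C : Surface (S ⊕ T)) (D : Surface (S' ⊕ T')) (f : (S → Bool) → L) (f' : (S' → Bool) → L) :
    transfer s (disj C D) (fun σ => f (σ ∘ Sum.inl) * f' (σ ∘ Sum.inr))
      = fun τ => transfer s C f (τ ∘ Sum.inl) * transfer s D f' (τ ∘ Sum.inr) := by
  classical
  have := Fintype.ofFinite S
  have := Fintype.ofFinite T
  have := Fintype.ofFinite S'
  have := Fintype.ofFinite T'
  funext τ
  rw [← Sum.elim_comp_inl_inr τ]
  simp only [transfer_apply, stateSum_disj, sum_sumArrow, Sum.elim_comp_inl, Sum.elim_comp_inr,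
    Fintype.prod_sum_type, Sum.elim_inl, Sum.elim_inr, Units.val_mul]
  rw [mul_mul_mul_comm, Finset.sum_mul_sum]
  congr 1
  refine Finset.sum_congr rfl fun σ _ => Finset.sum_congr rfl fun σ' _ => ?_
  ring

open Classical in
-- The exponent is `n - 1` from the surface plus one for each target circle. In genus `0` it is `0`
-- for unit and multiplication, `1` for comultiplication and `-1` for the counit.
theorem transfer_connected {S T : Type} [Finite S] [Fintype T] (n : ℕ) (f : (S → Bool) → L)
    (τ : T → Bool) :
    transfer s (connected (S ⊕ T) n) f τ
      = ∑ b, if τ = fun _ => b then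
          f (fun _ => b) * ((s.diff b ^ ((n : ℤ) - 1 + Fintype.card T) : Lˣ) : L) else 0 := by
  have := Fintype.ofFinite S
  simp only [transfer_apply, stateSum_connected, Finset.mul_sum, Finset.sum_mul]
  rw [Finset.sum_comm]
  refine Finset.sum_congr rfl fun b _ => ?_
  rw [Finset.sum_eq_single fun _ => b]
  · have : ((fun _ => b) = Sum.elim (fun _ : S => b) τ) ↔ τ = fun _ => b := by
      simp only [funext_iff, Sum.forall, Sum.elim_inl, Sum.elim_inr, implies_true, true_and]
      exact forall_congr' fun _ => eq_comm
    simp only [this]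
    split_ifs with hτ
    · subst hτ
      rw [mul_assoc, ← Units.val_mul, zpow_add]
      simp
    · simp
  · intro σ _ hσ
    rw [if_neg, mul_zero, zero_mul]
    intro h
    exact hσ (funext fun x => (congrFun h (Sum.inl x)).symm)
  · simp

end Surface

/-! ### Evaluation of the algebra and its tensor powers at the roots -/

namespace Splitting

variable {R L : Type} [CommRing R] [Field L] [Algebra R L] {h t : R} (s : Splitting L h t)

/-- Evaluation of `A = R[X] / (X² - h X - t)` at a root. -/
def eval (b : Bool) : RankTwo.Alg h t →ₐ[R] L :=
  AdjoinRoot.liftAlgHom (RankTwo.poly h t) (Algebra.ofId R L) (s.root b) (by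
    have := s.root_mul_root b
    simp [RankTwo.poly]
    linear_combination this)

@[simp]
theorem eval_x (b : Bool) : s.eval b (RankTwo.x h t) = s.root b := by
  simp [eval, RankTwo.x]

@[simp]
theorem eval_of (b : Bool) (c : R) :
    s.eval b (AdjoinRoot.of (RankTwo.poly h t) c) = algebraMap R L c := by
  simp [eval, Algebra.ofId_apply]

/-- This and `sum_root_inv_diff` are Euler's identities for `∑ rⁱ / f'(r)` over the roots of `f = X²
- hX - t`, with `i = 0, 1`. They express the counit on `1` and `X` through the roots. -/
theorem sum_inv_diff : ((s.diff true)⁻¹ : L) + ((s.diff false)⁻¹ : L) = 0 := by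
  have h1 : (s.diff false : L) = -s.diff true := s.diff_not true
  rw [h1, inv_neg]
  ring

theorem sum_root_inv_diff :
    s.root true * (s.diff true : L)⁻¹ + s.root false * (s.diff false : L)⁻¹ = 1 := by
  have h1 : (s.diff false : L) = -s.diff true := s.diff_not true
  have h2 : (s.diff true : L) = s.root true - s.root false := s.diff_eq true
  have h3 : (s.diff true : L) ≠ 0 := Units.ne_zero _
  rw [h1, inv_neg]
  field_simp
  rw [h2]; ring

variable {S S' : Type} [Finite S] [Finite S']

/-- The evaluation of tensors at all choices of roots. -/
def evalTensor (S : Type) [Finite S] :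
    (⨂[R] _ : S, RankTwo.Alg h t) →ₗ[R] ((S → Bool) → L) :=
  letI := Fintype.ofFinite S
  LinearMap.pi fun σ => PiTensorProduct.lift
    ((MultilinearMap.mkPiAlgebra R S L).compLinearMap fun b => (s.eval (σ b)).toLinearMap)

@[simp]
theorem evalTensor_tprod [Fintype S] (x : S → RankTwo.Alg h t) (σ : S → Bool) :
    s.evalTensor S (PiTensorProduct.tprod R x) σ = ∏ b, s.eval (σ b) (x b) := by
  simp only [evalTensor, LinearMap.pi_apply, PiTensorProduct.lift.tprod]
  simp only [MultilinearMap.compLinearMap_apply, MultilinearMap.mkPiAlgebra_apply]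
  congr!

theorem evalTensor_tmulEquiv (x : ⨂[R] _ : S, RankTwo.Alg h t)
    (y : ⨂[R] _ : S', RankTwo.Alg h t) :
    s.evalTensor (S ⊕ S') (PiTensorProduct.tmulEquiv R _ (x ⊗ₜ[R] y))
      = fun σ => s.evalTensor S x (σ ∘ Sum.inl) * s.evalTensor S' y (σ ∘ Sum.inr) := by
  classical
  have := Fintype.ofFinite S
  have := Fintype.ofFinite S'
  funext σ
  induction x using PiTensorProduct.induction_on with
  | add x x' hx hx' => simp only [TensorProduct.add_tmul, map_add, Pi.add_apply, hx, hx', add_mul]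
  | smul_tprod r x =>
    induction y using PiTensorProduct.induction_on with
    | add y y' hy hy' =>
      simp only [TensorProduct.tmul_add, map_add, Pi.add_apply, hy, hy', mul_add]
    | smul_tprod r' y =>
      simp only [TensorProduct.tmul_smul, ← TensorProduct.smul_tmul', map_smul, Pi.smul_apply,
        PiTensorProduct.tmulEquiv_apply, evalTensor_tprod, Fintype.prod_sum_type, Sum.elim_inl,
        Sum.elim_inr, Function.comp, smul_mul_smul_comm, smul_smul, mul_comm]

variable [Nontrivial R]

theorem sum_eval_inv_diff (a : RankTwo.Alg h t) :
    ∑ b, s.eval b a * (s.diff b : L)⁻¹ = algebraMap R L (RankTwo.counit h t a) := by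
  have key : ∑ b, (s.diff b : L)⁻¹ • (s.eval b).toLinearMap
      = (Algebra.linearMap R L).comp (RankTwo.counit h t) := by
    refine RankTwo.hom_ext h t ?_ ?_
    · simpa [RankTwo.counit_one] using s.sum_inv_diff
    · simpa [RankTwo.counit_x, mul_comm] using s.sum_root_inv_diff
  simpa [mul_comm] using LinearMap.congr_fun key a

/-- At a pair of roots, `Δ(1)` takes the value `root a + root b - h`, the same expression as the
weight of a tube. -/
theorem eval_comul (a b : Bool) (y : RankTwo.Alg h t) :
    TensorProduct.lift ((LinearMap.mul R L).compl₁₂ (s.eval a).toLinearMap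
      (s.eval b).toLinearMap) (RankTwo.comul h t y)
      = if a = b then s.eval a y * s.diff a else 0 := by
  have key : TensorProduct.lift ((LinearMap.mul R L).compl₁₂ (s.eval a).toLinearMap
      (s.eval b).toLinearMap) ∘ₗ (RankTwo.comul h t)
      = (if a = b then (s.diff a : L) else 0) • (s.eval a).toLinearMap := by
    rw [← s.root_add_root]
    refine RankTwo.hom_ext h t ?_ ?_
    · simp [RankTwo.comul_one, Algebra.smul_def]
      ring
    · have := s.root_mul_root a
      simp [RankTwo.comul_x, Algebra.smul_def]
      linear_combination -this
  have := LinearMap.congr_fun key y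
  rw [LinearMap.comp_apply] at this
  rw [this]
  split_ifs <;> simp [mul_comm]

/-- The matrix inverse to the values of the basis `1`, `X` at the roots. -/
def dualWeight (i : Fin 2) (b : Bool) : L :=
  ![s.root b - algebraMap R L h, 1] i * (s.diff b : L)⁻¹

/-- The basis dual to `1, X` for the pairing `ε(yz)` is `X - h, 1`; the sum over the roots computes
this pairing. -/
theorem sum_dualWeight (i j : Fin 2) :
    ∑ b, s.dualWeight i b * s.eval b (RankTwo.basis h t j) = if j = i then 1 else 0 := by
  have h1 := s.sum_inv_diff
  have h2 := s.sum_root_inv_diff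
  have h3 := s.root_mul_root true
  have h4 := s.root_mul_root false
  fin_cases i <;> fin_cases j <;> simp [dualWeight]
  · linear_combination h2 - algebraMap R L h * h1
  · linear_combination (s.diff true : L)⁻¹ * h3 + (s.diff false : L)⁻¹ * h4
      + algebraMap R L t * h1
  · exact h1
  · linear_combination h2

theorem evalTensor_injective (hinj : Function.Injective (algebraMap R L)) (S : Type) [Finite S] :
    Function.Injective (s.evalTensor S) := by
  classical
  have := Fintype.ofFinite S
  let B := Basis.piTensorProduct (fun _ : S => RankTwo.basis h t)
  rw [injective_iff_map_eq_zero]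
  intro x hx
  refine B.ext_elem fun κ => hinj ?_
  -- Every coordinate in the tensor basis is recovered from the evaluations by a product of dual
  -- weights.
  have key : (∑ σ : S → Bool, (∏ b, s.dualWeight (κ b) (σ b)) •
      (LinearMap.proj σ ∘ₗ s.evalTensor S)) = Algebra.linearMap R L ∘ₗ B.coord κ := by
    refine B.ext fun κ' => ?_
    simp only [B, LinearMap.sum_apply, LinearMap.smul_apply, LinearMap.comp_apply,
      LinearMap.proj_apply, Basis.piTensorProduct_apply, evalTensor_tprod, smul_eq_mul,
      ← Finset.prod_mul_distrib]
    -- The sum over all choices of roots factors into one sum for each tensor factor.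
    rw [← Fintype.prod_sum (fun a b => s.dualWeight (κ a) b * s.eval b (RankTwo.basis h t (κ' a)))]
    simp only [sum_dualWeight]
    rw [← Basis.piTensorProduct_apply]
    simp [Finsupp.single_apply, Finset.prod_ite_zero]
  have := LinearMap.congr_fun key x
  simpa [hx] using this.symm

end Splitting

/-! ### Elementary cobordisms and the structure maps of the algebra -/

namespace Splitting

variable {R L : Type} [CommRing R] [Field L] [Algebra R L] {h t : R} (s : Splitting L h t)

theorem transfer_unit (x : Empty → RankTwo.Alg h t) :
    Surface.transfer s (Surface.connected (Empty ⊕ Unit) 0)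
        (s.evalTensor Empty (PiTensorProduct.tprod R x))
      = s.evalTensor Unit (PiTensorProduct.tprod R fun _ => 1) := by
  funext τ
  rw [Surface.transfer_connected, Fintype.sum_eq_single (τ ())]
  · rw [if_pos rfl]; simp
  · intro b hb
    rw [if_neg]
    rintro rfl
    exact hb rfl

theorem transfer_mul (x : Unit ⊕ Unit → RankTwo.Alg h t) :
    Surface.transfer s (Surface.connected ((Unit ⊕ Unit) ⊕ Unit) 0)
        (s.evalTensor (Unit ⊕ Unit) (PiTensorProduct.tprod R x))
      = s.evalTensor Unit
          (PiTensorProduct.tprod R fun _ => x (Sum.inl ()) * x (Sum.inr ())) := by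
  funext τ
  rw [Surface.transfer_connected, Fintype.sum_eq_single (τ ())]
  · rw [if_pos rfl]; simp
  · intro b hb
    rw [if_neg]
    rintro rfl
    exact hb rfl

variable [Nontrivial R]

theorem transfer_counit (x : Unit → RankTwo.Alg h t) (y : Empty → RankTwo.Alg h t) :
    Surface.transfer s (Surface.connected (Unit ⊕ Empty) 0)
        (s.evalTensor Unit (PiTensorProduct.tprod R x))
      = s.evalTensor Empty (RankTwo.counit h t (x ()) • PiTensorProduct.tprod R y) := by
  funext τ
  rw [Surface.transfer_connected, map_smul, Pi.smul_apply, Algebra.smul_def,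
    ← s.sum_eval_inv_diff, evalTensor_tprod]
  -- The empty set of circles has only one colouring, so both colours of the disc contribute, and
  -- their sum is the counit.
  have hτ : ∀ b, τ = fun _ => b := fun _ => Subsingleton.elim _ _
  simp [← hτ]

theorem transfer_comul (x : Unit → RankTwo.Alg h t) :
    Surface.transfer s (Surface.connected (Unit ⊕ (Unit ⊕ Unit)) 0)
        (s.evalTensor Unit (PiTensorProduct.tprod R x))
      = s.evalTensor (Unit ⊕ Unit) (PiTensorProduct.tmulEquiv R (RankTwo.Alg h t)
          (TensorProduct.map
            (PiTensorProduct.subsingletonEquiv (R := R) (s := fun _ : Unit => RankTwo.Alg h t)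
              ()).symm.toLinearMap
            (PiTensorProduct.subsingletonEquiv (R := R) (s := fun _ : Unit => RankTwo.Alg h t)
              ()).symm.toLinearMap
            (RankTwo.comul h t (x ())))) := by
  classical
  -- Evaluating the two-circle tensor amounts to evaluating each factor and multiplying, which is
  -- the form in `eval_comul`.
  have key : ∀ (y : RankTwo.Alg h t ⊗[R] RankTwo.Alg h t) (τ : Unit ⊕ Unit → Bool),
      s.evalTensor (Unit ⊕ Unit) (PiTensorProduct.tmulEquiv R (RankTwo.Alg h t)
          (TensorProduct.map
            (PiTensorProduct.subsingletonEquiv (R := R) (s := fun _ : Unit => RankTwo.Alg h t)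
              ()).symm.toLinearMap
            (PiTensorProduct.subsingletonEquiv (R := R) (s := fun _ : Unit => RankTwo.Alg h t)
              ()).symm.toLinearMap y)) τ
        = TensorProduct.lift ((LinearMap.mul R L).compl₁₂ (s.eval (τ (Sum.inl ()))).toLinearMap
            (s.eval (τ (Sum.inr ()))).toLinearMap) y := by
    intro y τ
    induction y using TensorProduct.induction_on with
    | zero => simp
    | add y y' hy hy' => simp only [map_add, Pi.add_apply, hy, hy']
    | tmul y y' =>
      rw [TensorProduct.map_tmul, evalTensor_tmulEquiv]
      simp
  funext τ
  rw [key, eval_comul, Surface.transfer_connected, Fintype.sum_eq_single (τ (Sum.inl ()))]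
  · refine if_congr ?_ ?_ rfl
    · simp only [funext_iff, Sum.forall, eq_comm]
      exact ⟨fun h => h.2 (), fun h => ⟨fun _ => trivial, fun _ => h⟩⟩
    · simp
  · intro b hb
    rw [if_neg]
    rintro rfl
    exact hb rfl

end Splitting

/-- A functor on cobordisms with values in tensor powers of `R[X] / (X² - h X - t)` that becomes
the state sum after evaluation at the roots is a topological quantum field theory. -/
def Splitting.tqft {R L : Type} [CommRing R] [Nontrivial R] [Field L] [Algebra R L] {h t : R}
    (s : Splitting L h t) (hinj : Function.Injective (algebraMap R L)) (F : Cob ⥤ ModuleCat.{0} R)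
    (E : ∀ S : Cob, F.obj S ≃ₗ[R] ⨂[R] _ : S, RankTwo.Alg h t)
    (hE : ∀ (S T : Cob) (C : S ⟶ T) (x : ⨂[R] _ : S, RankTwo.Alg h t),
      s.evalTensor T (E T (F.map C ((E S).symm x)))
        = Surface.transfer s C (s.evalTensor S x)) :
    TQFT (RankTwo.frobenius h t) where
  functor := F
  equiv := E
  map_cyl {S T} e x := by
    have := Fintype.ofFinite S
    have := Fintype.ofFinite T
    -- Every axiom is an equality of tensors and may be tested after evaluation, where it is a
    -- statement about transfer operators.
    refine s.evalTensor_injective hinj T ?_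
    rw [hE]
    refine (Surface.transfer_cyl s e _).trans (funext fun τ => ?_)
    rw [s.evalTensor_tprod, s.evalTensor_tprod, ← e.prod_comp]
    simp
  map_union {S T S' T'} C D x y := by
    refine s.evalTensor_injective hinj (T ⊕ T') ?_
    refine (hE (S.union S') (T.union T') _ _).trans ?_
    refine (congrArg _ (s.evalTensor_tmulEquiv (E S x) (E S' y))).trans ?_
    refine (Surface.transfer_disj s C D _ _).trans ?_
    rw [s.evalTensor_tmulEquiv, ← hE, ← hE, LinearEquiv.symm_apply_apply,
      LinearEquiv.symm_apply_apply]
  map_unit x :=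
    s.evalTensor_injective hinj Unit ((hE Cob.empty Cob.circle _ _).trans (s.transfer_unit x))
  map_counit x y :=
    s.evalTensor_injective hinj Empty ((hE Cob.circle Cob.empty _ _).trans (s.transfer_counit x y))
  map_mul x :=
    s.evalTensor_injective hinj Unit
      ((hE (Cob.circle.union Cob.circle) Cob.circle _ _).trans (s.transfer_mul x))
  map_comul x :=
    s.evalTensor_injective hinj (Unit ⊕ Unit)
      ((hE Cob.circle (Cob.circle.union Cob.circle) _ _).trans (s.transfer_comul x))

/-! ### Surfaces recognized as results of attaching tubes -/

namespace Surface

section Recognition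

variable {B K E F : Type} [Finite K] [Finite E]

open Classical in
/-- A tube with both ends on the same component adds a handle to it. -/
theorem addTube_self (g : K → ℕ) (p : B → K) (i : K) :
    addTube g p i i = of (g + Pi.single i 1) p := by
  have := Fintype.ofFinite K
  symm
  refine of_eq_tubes id (Quot.mk _) Function.surjective_id (fun _ => rfl)
    (fun _ => rfl) (fun _ => rfl) fun φ => ?_
  simp [Pi.single_apply, add_sub_right_comm, mul_add, Finset.sum_add_distrib]

open Classical in
/-- A tube to an additional closed component is a connected sum. -/
theorem addTube_inr_inl (g : K → ℕ) (p : B → K) (c : ℕ) (i : K) :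
    addTube (Sum.elim g fun _ : Unit => c) (fun b => Sum.inl (p b)) (Sum.inr ()) (Sum.inl i)
      = of (g + Pi.single i c) p := by
  have := Fintype.ofFinite K
  symm
  refine of_eq_tubes (Sum.elim id fun _ => i) (fun k => Quot.mk _ (Sum.inl k))
    (fun k => ⟨Sum.inl k, rfl⟩) (fun _ => rfl) ?_ (fun _ => rfl) fun φ => ?_
  · rintro (k | u)
    · rfl
    · exact (Quot.sound ⟨(), rfl, rfl⟩ : Quot.mk _ (Sum.inr ()) = Quot.mk _ (Sum.inl i)).symm
  · simp only [Fintype.sum_sum_type]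
    simp [Pi.single_apply, add_sub_right_comm, mul_add, Finset.sum_add_distrib]
    ring

/-- Together with `addTube_inr_inl` and `addTube_inl_inl`, this identifies the terms of 4TU when two
of the discs lie on an additional closed component. -/
theorem addTube_inr_inr (g : K → ℕ) (p : B → K) (c : ℕ) :
    addTube (Sum.elim g fun _ : Unit => c) (fun b => Sum.inl (p b)) (Sum.inr ()) (Sum.inr ())
      = addClosed g p (c + 1) := by
  classical
  rw [addTube_self]
  refine of_eq_of (Equiv.refl _) ?_ fun _ => rfl
  rintro (k | u) <;> simp

theorem addTube_inl_inl (g : K → ℕ) (p : B → K) (c : ℕ) (i j : K) :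
    addTube (Sum.elim g fun _ : Unit => c) (fun b => Sum.inl (p b)) (Sum.inl i) (Sum.inl j)
      = addClosed (tubeGenus g (fun _ : Unit => i) fun _ => j) (fun b => Quot.mk _ (p b)) c :=
  (tubes_addClosed g p _ _ c).symm

theorem tubes_sum_unit (g : K → ℕ) (p : B → K) (s t : E → K) (i j : K) :
    tubes g p (Sum.elim s fun _ : Unit => i) (Sum.elim t fun _ : Unit => j)
      = addTube (tubeGenus g s t) (fun b => Quot.mk _ (p b)) (Quot.mk _ i) (Quot.mk _ j) :=
  (tubes_tubes g s t p _ _).symm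

open Classical in
-- A handle may be added before the other tubes, where it only changes the genus function. This lets
-- the inductions on the number of tubes proceed.
theorem tubes_sum_unit_self (g : K → ℕ) (p : B → K) (s t : E → K) (i : K) :
    tubes g p (Sum.elim s fun _ : Unit => i) (Sum.elim t fun _ : Unit => i)
      = tubes (g + Pi.single i 1) p s t := by
  have := Fintype.ofFinite K
  have := Fintype.ofFinite E
  have := Fintype.ofFinite (TubeComp s t)
  symm
  refine of_eq_tubes (Quot.mk _) (Quot.lift (Quot.mk _) ?_) Quot.mk_surjective
    ?_ (fun _ => rfl) (fun _ => rfl) fun φ => ?_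
  · rintro _ _ ⟨e, rfl, rfl⟩
    exact Quot.sound ⟨Sum.inl e, rfl, rfl⟩
  · rintro (e | e)
    · exact Quot.sound ⟨e, rfl, rfl⟩
    · rfl
  · rw [tubeGenus_sum]
    simp only [Fintype.sum_sum_type]
    simp [Pi.single_apply, add_sub_right_comm, mul_add, Finset.sum_add_distrib]
    ring

theorem tubes_reindex [Finite F] (ε : E ≃ F) (g : K → ℕ) (p : B → K) (s t : E → K) :
    tubes g p s t = tubes g p (s ∘ ε.symm) (t ∘ ε.symm) :=
  tubes_congr (Equiv.refl _) ε (fun _ => rfl) (fun _ => rfl) (by simp) (by simp)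

/-- Splitting off the last of `n + 1` tubes. -/
theorem tubes_fin_succ {n : ℕ} (g : K → ℕ) (p : B → K) (s t : Fin (n + 1) → K) :
    tubes g p s t
      = tubes g p (Sum.elim (fun e : Fin n => s e.castSucc) fun _ : Unit => s (Fin.last n))
          (Sum.elim (fun e => t e.castSucc) fun _ : Unit => t (Fin.last n)) := by
  refine (tubes_congr (Equiv.refl _) ((Equiv.optionEquivSumPUnit _).symm.trans
    finSuccEquivLast.symm) (fun _ => rfl) (fun _ => rfl) ?_ ?_).symm <;>
    rintro (e | e) <;> simp

theorem tubes_of_isEmpty [IsEmpty E] (g : K → ℕ) (p : B → K) (s t : E → K) :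
    tubes g p s t = of g p := by
  have := Fintype.ofFinite E
  have := Fintype.ofFinite K
  symm
  refine of_eq_tubes id (Quot.mk _) Function.surjective_id (fun e => isEmptyElim e)
    (fun _ => rfl) (fun _ => rfl) fun φ => ?_
  simp

/-- Every surface arises by tubes from discs and closed components. -/
theorem of_eq_tubes_discs [Finite B] (g : K → ℕ) (p : B → K) :
    of g p = tubes (Sum.elim (fun _ : B => 0) g) Sum.inl (fun b : B => Sum.inl b)
      fun b : B => Sum.inr (p b) := by
  have := Fintype.ofFinite B
  have := Fintype.ofFinite K
  refine of_eq_tubes (Sum.elim p id) (fun k => Quot.mk _ (Sum.inr k))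
    (fun k => ⟨Sum.inr k, rfl⟩) (fun _ => rfl) ?_ (fun _ => rfl) fun φ => ?_
  · rintro (b | k)
    · exact (Quot.sound ⟨b, rfl, rfl⟩ : Quot.mk _ (Sum.inl b) = Quot.mk _ (Sum.inr (p b))).symm
    · rfl
  · simp only [Fintype.sum_sum_type]
    simp

/-- Every surface arises by tubes from discs and spheres. -/
theorem of_eq_tubes_spheres [Finite B] (g : K → ℕ) (p : B → K) :
    of g p = tubes (fun _ : B ⊕ K => 0) Sum.inl
      (Sum.elim (fun b : B => Sum.inl b) fun e : (Σ k, Fin (g k)) => Sum.inr e.1)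
      (Sum.elim (fun b : B => Sum.inr (p b)) fun e : (Σ k, Fin (g k)) => Sum.inr e.1) := by
  have := Fintype.ofFinite B
  have := Fintype.ofFinite K
  refine of_eq_tubes (Sum.elim p id) (fun k => Quot.mk _ (Sum.inr k))
    (fun k => ⟨Sum.inr k, rfl⟩) ?_ ?_ (fun _ => rfl) fun φ => ?_
  · rintro (b | e) <;> rfl
  · rintro (b | k)
    · exact (Quot.sound ⟨Sum.inl b, rfl, rfl⟩ :
        Quot.mk _ (Sum.inl b) = Quot.mk _ (Sum.inr (p b))).symm
    · rfl
  · simp only [Fintype.sum_sum_type, Fintype.sum_sigma]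
    simp [mul_sub, Finset.sum_sub_distrib, mul_comm]
    ring

end Recognition

end Surface

/-! ### Consequences of the local relations -/

namespace Surface

section Relations

variable {k : Type} [CommRing k] {B K : Type} [Finite K]

theorem toModRel_fourTu (g : K → ℕ) (p : B → K) (a b c d : K) :
    toModRel k (addTube g p a b) + toModRel k (addTube g p c d)
      = toModRel k (addTube g p a c) + toModRel k (addTube g p b d) := by
  have h := (Submodule.Quotient.mk_eq_zero (localRel k B)).2
    (Submodule.subset_span (IsLocalRel.fourTu (k := k) g p ![a, b, c, d]))
  simp only [Submodule.Quotient.mk_sub, Submodule.Quotient.mk_add] at h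
  rw [← sub_eq_zero, ← h]
  simp only [toModRel, Matrix.cons_val]
  abel

theorem toModRel_addClosed_zero (g : K → ℕ) (p : B → K) : toModRel k (addClosed g p 0) = 0 :=
  (Submodule.Quotient.mk_eq_zero (localRel k B)).2
    (Submodule.subset_span (IsLocalRel.sphere g p))

theorem toModRel_addClosed_one (g : K → ℕ) (p : B → K) :
    toModRel k (addClosed g p 1) = (2 : k) • toModRel k (of g p) := by
  have h := (Submodule.Quotient.mk_eq_zero (localRel k B)).2
    (Submodule.subset_span (IsLocalRel.torus (k := k) g p))
  rw [Submodule.Quotient.mk_sub, sub_eq_zero] at h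
  rw [toModRel, h, toModRel, ← Submodule.Quotient.mk_smul]
  simp

/-- Neck cutting with the help of a closed component of genus `c`. -/
theorem toModRel_addTube_addClosed (g : K → ℕ) (p : B → K) (i j : K) (c : ℕ) [DecidableEq K] :
    toModRel k (addClosed g p (c + 1))
        + toModRel k (addClosed (tubeGenus g (fun _ : Unit => i) fun _ => j)
            (fun b => Quot.mk _ (p b)) c)
      = toModRel k (of (g + Pi.single i c) p) + toModRel k (of (g + Pi.single j c) p) := by
  -- Two of the discs are on the closed component, the other two on `i` and `j`.
  have h := toModRel_fourTu (k := k) (Sum.elim g fun _ : Unit => c) (fun b => Sum.inl (p b))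
    (Sum.inr ()) (Sum.inr ()) (Sum.inl i) (Sum.inl j)
  rw [addTube_inr_inr, addTube_inl_inl, addTube_inr_inl, addTube_inr_inl] at h
  rw [h]
  congr!

/-- Neck cutting with a torus and `i = j` has twice the surface with a handle at `i` on both sides,
once by relation T and once as a connected sum. What is left is the closed component of genus `2`;
another component must exist to carry `i`. -/
theorem toModRel_addClosed_two [Nonempty K] (g : K → ℕ) (p : B → K) :
    toModRel k (addClosed g p 2) = 0 := by
  classical
  obtain ⟨i⟩ := ‹Nonempty K›
  have h := toModRel_addTube_addClosed (k := k) g p i i 1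
  rw [toModRel_addClosed_one] at h
  have h' := addTube_self g p i
  rw [addTube, tubes] at h'
  rw [h', two_smul] at h
  refine add_right_cancel (h.trans ?_)
  rw [zero_add]

/-- This is neck cutting with a torus: the term of genus `2` vanishes and the torus becomes the
factor `2`. When `2` is invertible, every tube can be traded for handles. -/
theorem two_smul_toModRel_addTube (g : K → ℕ) (p : B → K) (i j : K) :
    (2 : k) • toModRel k (addTube g p i j)
      = toModRel k (addTube g p i i) + toModRel k (addTube g p j j) := by
  classical
  have : Nonempty K := ⟨i⟩
  have h := toModRel_addTube_addClosed (k := k) g p i j 1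
  rw [toModRel_addClosed_two, zero_add, toModRel_addClosed_one] at h
  rw [addTube_self, addTube_self]
  convert h using 3
  congr!

open Classical in
-- Neck cutting with a closed component of genus `2`, where the second term vanishes by
-- `toModRel_addClosed_two`. So a pair of handles can leave its component as half a surface of genus
-- `3`.
theorem toModRel_addClosed_three (g : K → ℕ) (p : B → K) (i : K) :
    toModRel k (addClosed g p 3) = (2 : k) • toModRel k (of (g + Pi.single i 2) p) := by
  have : Nonempty K := ⟨i⟩
  have h := toModRel_addTube_addClosed (k := k) g p i i 2
  have : Nonempty (TubeComp (fun _ : Unit => i) fun _ => i) := ⟨Quot.mk _ i⟩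
  rw [toModRel_addClosed_two, add_zero] at h
  rw [two_smul, h]

end Relations

/-! ### Generators when `2` is invertible -/

section Spanning

variable {k : Type} [CommRing k] {B : Type} [Finite B] (W : Submodule k (ModRel k B))

/-- When `2` is invertible, linear combinations of surfaces are generated, over the operator that
adds a closed component of genus `3`, by unions of discs and of discs with one handle. -/
theorem toModRel_mem_of_discs [Invertible (2 : k)] (η : ModRel k B →ₗ[k] ModRel k B)
    (hη : ∀ (K : Type) [Finite K] (g : K → ℕ) (p : B → K),
      η (toModRel k (of g p)) = toModRel k (addClosed g p 3))
    (hW : ∀ x ∈ W, η x ∈ W)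
    (hdisc : ∀ g : B → ℕ, (∀ b, g b ≤ 1) → toModRel k (of g id) ∈ W) (C : Surface B) :
    toModRel k C ∈ W := by
  classical
  have two_mem : ∀ x, (2 : k) • x ∈ W → x ∈ W := by
    intro x hx
    have := W.smul_mem (⅟2 : k) hx
    rwa [smul_smul, invOf_mul_self, one_smul] at this
  -- Two handles on any component act as half of `η`.
  have handle_mem : ∀ (K : Type) [Finite K] (g : K → ℕ) (p : B → K) (i : K),
      toModRel k (of g p) ∈ W → toModRel k (of (g + Pi.single i 2) p) ∈ W := by
    intro K _ g p i h
    refine two_mem _ ?_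
    have := toModRel_addClosed_three (k := k) g p i
    rw [← hη] at this
    have h2 := hW _ h
    rw [this] at h2
    convert h2
  -- Induction on the total genus: pairs of handles are removed until every disc carries at most
  -- one.
  have discs : ∀ (n : ℕ) (g : B → ℕ), ∑ᶠ b, g b = n → toModRel k (of g id) ∈ W := by
    have := Fintype.ofFinite B
    intro n
    induction n using Nat.strong_induction_on with
    | _ n ih =>
      intro g hg
      by_cases h : ∀ b, g b ≤ 1
      · exact hdisc g h
      · push Not at h
        obtain ⟨b, hb⟩ := h
        have hle : Pi.single b 2 ≤ g := by
          intro b'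
          by_cases h : b' = b
          · subst h; simpa using Nat.succ_le_of_lt hb
          · simp [h]
        rw [← tsub_add_cancel_of_le hle]
        refine handle_mem _ _ _ _ (ih _ ?_ _ rfl)
        rw [← hg, finsum_eq_sum_of_fintype, finsum_eq_sum_of_fintype]
        refine Finset.sum_lt_sum (fun b' _ => tsub_le_self) ⟨b, Finset.mem_univ _, ?_⟩
        simp only [Pi.sub_apply, Pi.single_eq_same]
        omega
  have closed : ∀ (m : ℕ) (g : B ⊕ Fin m → ℕ), toModRel k (of g Sum.inl) ∈ W := by
    intro m
    induction m with
    | zero =>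
      intro g
      have : of g Sum.inl = of (fun b => g (Sum.inl b)) (id : B → B) := by
        refine of_eq_of (Equiv.sumEmpty B (Fin 0)) ?_ fun _ => rfl
        rintro (b | b)
        · rfl
        · exact b.elim0
      rw [this]
      exact discs _ _ rfl
    | succ m ih =>
      have add_closed : ∀ (c : ℕ) (g : B ⊕ Fin m → ℕ),
          toModRel k (addClosed g Sum.inl c) ∈ W := by
        intro c g
        -- Genus `0` and `1` are the relations S and T; larger genera descend by two through
        -- `handle_mem`.
        induction c using Nat.twoStepInduction with
        | zero => rw [toModRel_addClosed_zero]; exact W.zero_mem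
        | one => rw [toModRel_addClosed_one]; exact W.smul_mem _ (ih g)
        | more c h _ =>
          have h2 := handle_mem _ _ _ (Sum.inr ()) h
          have : addClosed g (Sum.inl : B → B ⊕ Fin m) (c + 2)
              = of ((Sum.elim g fun _ => c) + Pi.single (Sum.inr ()) 2)
                fun b => Sum.inl (Sum.inl b) := by
            refine of_eq_of (Equiv.refl _) ?_ fun _ => rfl
            rintro (b | b) <;> simp
          rw [this]
          convert h2
      intro g
      let e : B ⊕ Fin (m + 1) ≃ (B ⊕ Fin m) ⊕ Unit :=
        (Equiv.sumCongr (Equiv.refl B) ((finSuccEquivLast).trans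
          (Equiv.optionEquivSumPUnit _))).trans (Equiv.sumAssoc _ _ _).symm
      have : of g Sum.inl = addClosed (fun x => g (e.symm (Sum.inl x))) (Sum.inl : B → B ⊕ Fin m)
          (g (e.symm (Sum.inr ()))) := by
        refine of_eq_of e ?_ fun _ => rfl
        intro x
        obtain ⟨y, rfl⟩ := e.symm.surjective x
        rw [e.apply_symm_apply]
        rcases y with y | y <;> rfl
      rw [this]
      exact add_closed _ _
  -- Trading the last tube for handles at its ends changes the genera, so the induction runs over
  -- all genus functions at once.
  have tube : ∀ (m : ℕ) (K : Type) [Finite K] (p : B → K)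
      (_ : ∀ g : K → ℕ, toModRel k (of g p) ∈ W) (g : K → ℕ) (s t : Fin m → K),
      toModRel k (tubes g p s t) ∈ W := by
    intro m K _ p hp
    induction m with
    | zero =>
      intro g s t
      rw [tubes_of_isEmpty]
      exact hp g
    | succ m ih =>
      intro g s t
      refine two_mem _ ?_
      rw [tubes_fin_succ, tubes_sum_unit, two_smul_toModRel_addTube, ← tubes_sum_unit,
        ← tubes_sum_unit, tubes_sum_unit_self, tubes_sum_unit_self]
      exact W.add_mem (ih _ _ _) (ih _ _ _)
  obtain ⟨n, g, p, rfl⟩ := C.exists_of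
  rw [of_eq_tubes_discs, tubes_reindex (Finite.equivFin B)]
  exact tube _ _ _ (closed n) _ _ _

end Spanning

end Surface

/-! ### Generators in the presence of a special circle -/

namespace Surface

section SpanningSpecial

variable {k : Type} [CommRing k] {B : Type} [Finite B] (W : Submodule k (ModRel k B))

/-- Linear combinations of surfaces are generated, over the operator that adds a handle to the
component of a special boundary circle `b₀`, by the surfaces of genus `0` in which some boundary
circles lie on the component of `b₀` and all the others bound discs. -/
theorem toModRel_mem_of_stars (b₀ : B) (η : ModRel k B →ₗ[k] ModRel k B)
    (hη : ∀ (K : Type) [Finite K] (g : K → ℕ) (p : B → K),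
      η (toModRel k (of g p)) = toModRel k (addTube g p (p b₀) (p b₀)))
    (hW : ∀ x ∈ W, η x ∈ W)
    (hstar : ∀ (F : Type) [Finite F] (u : F → B), Function.Injective u → (∀ f, u f ≠ b₀) →
      toModRel k (tubes (fun _ => 0) id u fun _ => b₀) ∈ W) (C : Surface B) :
    toModRel k C ∈ W := by
  classical
  -- The `m` additional spheres are removed one at a time. By injectivity of `u`, at most one tube
  -- joins a given sphere to the special component.
  have closed : ∀ (m : ℕ) (F : Type) [Finite F] (u : F → B ⊕ Fin m), Function.Injective u →
      (∀ f, u f ≠ Sum.inl b₀) →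
      toModRel k (tubes (fun _ => 0) Sum.inl u fun _ => Sum.inl b₀) ∈ W := by
    intro m
    induction m with
    | zero =>
      intro F _ u hu hu0
      let α : B ⊕ Fin 0 ≃ B := Equiv.sumEmpty _ _
      rw [tubes_congr (g := fun _ => 0) (p := Sum.inl) (s := u) (t := fun _ => Sum.inl b₀)
        α (Equiv.refl F) (g' := fun _ => 0) (p' := id) (s' := fun f => α (u f))
        (t' := fun _ => b₀) (fun _ => rfl) (fun _ => rfl) (fun _ => rfl) (fun _ => rfl)]
      refine hstar F _ (α.injective.comp hu) fun f hf => hu0 f (α.injective hf)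
    | succ m ih =>
      intro F _ u hu hu0
      let α : B ⊕ Fin (m + 1) ≃ (B ⊕ Fin m) ⊕ Unit :=
        (Equiv.sumCongr (Equiv.refl B) ((finSuccEquivLast).trans
          (Equiv.optionEquivSumPUnit _))).trans (Equiv.sumAssoc _ _ _).symm
      rw [tubes_congr (g := fun _ => 0) (p := Sum.inl) (s := u) (t := fun _ => Sum.inl b₀)
        α (Equiv.refl F) (g' := Sum.elim (fun _ => 0) fun _ => 0)
        (p' := fun b => Sum.inl (Sum.inl b)) (s' := fun f => α (u f))
        (t' := fun _ => Sum.inl (Sum.inl b₀)) (by intro x; rcases α x with y | y <;> rfl)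
        (fun _ => rfl) (fun _ => rfl) (fun _ => rfl)]
      by_cases h : ∃ f₀, α (u f₀) = Sum.inr ()
      · obtain ⟨f₀, hf₀⟩ := h
        have hex : ∀ f : {f // f ≠ f₀}, ∃ x, α (u f.1) = Sum.inl x := by
          intro f
          rcases hx : α (u f.1) with x | x
          · exact ⟨x, rfl⟩
          · exact absurd (hu (α.injective (hx.trans hf₀.symm))) f.2
        choose v hv using hex
        let ε : {f // f ≠ f₀} ⊕ Unit ≃ F :=
          (Equiv.optionEquivSumPUnit _).symm.trans (Equiv.optionSubtypeNe f₀)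
        have := tubes_tubes_inl (B := B) (fun _ : B ⊕ Fin m => 0) (fun _ : Unit => 0) v
          (fun _ => Sum.inl b₀) (fun b => Sum.inl (Sum.inl b)) (fun _ : Unit => Sum.inr ())
          (fun _ : Unit => Sum.inl (Sum.inl b₀))
        have hs : (fun f => α (u f)) ∘ ε = Sum.elim (fun f => Sum.inl (v f))
            fun _ : Unit => Sum.inr () := by
          funext f
          rcases f with f | f
          · exact hv f
          · exact hf₀
        have ht : (fun _ : F => (Sum.inl (Sum.inl b₀) : (B ⊕ Fin m) ⊕ Unit)) ∘ ε
            = Sum.elim (fun _ => Sum.inl (Sum.inl b₀))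
              fun _ : Unit => Sum.inl (Sum.inl b₀) := by
          funext f
          rcases f with f | f <;> rfl
        rw [tubes_reindex ε.symm, Equiv.symm_symm, hs, ht, ← this]
        change toModRel k (addTube (Sum.elim _ fun _ : Unit => 0)
          (fun b => Sum.inl (Quot.mk _ (Sum.inl b))) (Sum.inr ())
          (Sum.inl (Quot.mk _ (Sum.inl b₀)))) ∈ W
        -- A sphere joined by one tube is a trivial connected summand.
        rw [addTube_inr_inl, Pi.single_zero, add_zero]
        refine ih {f // f ≠ f₀} v (fun f f' hff => Subtype.ext (hu (α.injective ?_))) ?_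
        · rw [hv, hv, hff]
        · intro f hf
          refine hu0 f.1 (α.injective ?_)
          rw [hv, hf]
          rfl
      · have hex : ∀ f, ∃ x, α (u f) = Sum.inl x := by
          intro f
          rcases hx : α (u f) with x | x
          · exact ⟨x, rfl⟩
          · exact absurd ⟨f, hx⟩ h
        choose v hv using hex
        -- A sphere that no tube reaches is a closed component, so relation S applies.
        have := tubes_addClosed (B := B) (fun _ : B ⊕ Fin m => 0) Sum.inl v
          (fun _ => Sum.inl b₀) 0
        simp only [hv]
        rw [← this, toModRel_addClosed_zero]
        exact W.zero_mem
  -- `m` counts the tubes still in arbitrary position; those indexed by `F` already join distinct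
  -- other components to the special one.
  have tube : ∀ (m : ℕ) (K : Type) [Finite K] (p : B → K)
      (_ : ∀ (F : Type) [Finite F] (u : F → K), Function.Injective u → (∀ f, u f ≠ p b₀) →
        toModRel k (tubes (fun _ => 0) p u fun _ => p b₀) ∈ W) (s t : Fin m → K)
      (F : Type) [Finite F] (u : F → K), Function.Injective u → (∀ f, u f ≠ p b₀) →
        toModRel k (tubes (fun _ => 0) p (Sum.elim s u) (Sum.elim t fun _ => p b₀)) ∈ W := by
    intro m K _ p hp
    induction m with
    | zero =>
      intro s t F _ u hu hu0
      rw [tubes_reindex (Equiv.emptySum (Fin 0) F)]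
      exact hp F u hu hu0
    | succ m ih =>
      intro s t F _ u hu hu0
      -- A tube from `i` to the special component is a handle there, hence an application of `η`, if
      -- `i` is special or already joined by `u`. Otherwise it enlarges `F`.
      have key : ∀ i : K, toModRel k (addTube
          (tubeGenus (fun _ => 0) (Sum.elim (fun e : Fin m => s e.castSucc) u)
            (Sum.elim (fun e : Fin m => t e.castSucc) fun _ => p b₀))
          (fun b => Quot.mk _ (p b)) (Quot.mk _ i) (Quot.mk _ (p b₀))) ∈ W := by
        intro i
        by_cases hi : i = p b₀ ∨ ∃ f, u f = i
        · have hq : (Quot.mk _ i : TubeComp (Sum.elim (fun e : Fin m => s e.castSucc) u)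
            (Sum.elim (fun e : Fin m => t e.castSucc) fun _ => p b₀)) = Quot.mk _ (p b₀) := by
            obtain rfl | ⟨f, rfl⟩ := hi
            · rfl
            · exact Quot.sound ⟨Sum.inr f, rfl, rfl⟩
          rw [hq, ← hη]
          exact hW _ (ih _ _ F u hu hu0)
        · push Not at hi
          rw [← tubes_sum_unit, tubes_reindex (Equiv.sumAssoc _ _ _)]
          have := ih (fun e => s e.castSucc) (fun e => t e.castSucc) (F ⊕ Unit)
            (Sum.elim u fun _ => i) ?_ ?_
          · convert this using 3
            · funext e; rcases e with e | e | e <;> rfl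
            · funext e; rcases e with e | e | e <;> rfl
          · rintro (f | f) (f' | f') h
            · exact congrArg Sum.inl (hu h)
            · exact absurd h (hi.2 f)
            · exact absurd h.symm (hi.2 f')
            · rfl
          · rintro (f | f)
            · exact hu0 f
            · exact hi.1
      let ε : Fin (m + 1) ⊕ F ≃ (Fin m ⊕ F) ⊕ Unit :=
        (Equiv.sumCongr (finSuccEquivLast.trans (Equiv.optionEquivSumPUnit _))
          (Equiv.refl F)).trans ((Equiv.sumAssoc _ _ _).trans
            ((Equiv.sumCongr (Equiv.refl _) (Equiv.sumComm _ _)).trans (Equiv.sumAssoc _ _ _).symm))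
      have hs : (Sum.elim s u) ∘ ε.symm = Sum.elim (Sum.elim (fun e : Fin m => s e.castSucc) u)
          fun _ : Unit => s (Fin.last m) := by
        funext e; rcases e with (e | e) | e <;> simp [ε]
      have ht : (Sum.elim t fun _ => p b₀) ∘ ε.symm
          = Sum.elim (Sum.elim (fun e : Fin m => t e.castSucc) fun _ => p b₀)
            fun _ : Unit => t (Fin.last m) := by
        funext e; rcases e with (e | e) | e <;> simp [ε]
      rw [tubes_reindex ε, hs, ht, tubes_sum_unit]
      -- With the third and fourth disc on the special component, 4TU replaces the last tube by
      -- three tubes that end there.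
      have h4 := toModRel_fourTu (k := k)
        (tubeGenus (fun _ => 0) (Sum.elim (fun e : Fin m => s e.castSucc) u)
            (Sum.elim (fun e : Fin m => t e.castSucc) fun _ => p b₀))
        (fun b => Quot.mk _ (p b)) (Quot.mk _ (s (Fin.last m))) (Quot.mk _ (t (Fin.last m)))
        (Quot.mk _ (p b₀)) (Quot.mk _ (p b₀))
      rw [eq_sub_of_add_eq h4]
      exact W.sub_mem (W.add_mem (key _) (key _)) (key _)
  obtain ⟨n, g, p, rfl⟩ := C.exists_of
  rw [of_eq_tubes_spheres, tubes_reindex (Finite.equivFin _),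
    tubes_reindex (Equiv.sumEmpty _ Empty).symm]
  have h := tube _ (B ⊕ Fin n) Sum.inl (closed n)
    (Sum.elim (fun b : B => Sum.inl b) (fun e : (Σ k, Fin (g k)) => Sum.inr e.1) ∘
      (Finite.equivFin _).symm)
    (Sum.elim (fun b : B => Sum.inr (p b)) (fun e : (Σ k, Fin (g k)) => Sum.inr e.1) ∘
      (Finite.equivFin _).symm) Empty Empty.elim (fun x => x.elim) (fun x => x.elim)
  convert h using 3
  · funext e; rcases e with e | e
    · rfl
    · exact e.elim
  · funext e; rcases e with e | e
    · rfl
    · exact e.elim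

end SpanningSpecial

end Surface

/-! ### From state sums to the tautological functor -/

namespace Surface

variable {R L : Type} [CommRing R] [Field L] [Algebra R L] {h t : R} (s : Splitting L h t)
variable {k : Type} [CommRing k] [Algebra k L] {S T U : Type} [Finite S] [Finite T] [Finite U]

theorem transferAt_add (v w : (S → Bool) → L) (x : ModRel k (S ⊕ T)) :
    transferAt s k (v + w) x = transferAt s k v x + transferAt s k w x := by
  induction x using modRel_induction with
  | zero => simp
  | add x y hx hy => simp only [map_add, hx, hy]; abel
  | smul b x hx => simp only [map_smul, hx, smul_add]
  | of C => simp

theorem transferAt_zero (x : ModRel k (S ⊕ T)) : transferAt s k (0 : (S → Bool) → L) x = 0 := by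
  simpa using transferAt_smul s 0 (0 : (S → Bool) → L) x

theorem transferAt_compModRel (v : (S → Bool) → L) (x : ModRel k (S ⊕ T))
    (y : ModRel k (T ⊕ U)) :
    transferAt s k v (compModRel k S T U x y) = transferAt s k (transferAt s k v x) y := by
  induction x using modRel_induction with
  | zero => simp [transferAt_zero]
  | add x x' hx hx' => simp only [map_add, LinearMap.add_apply, hx, hx', transferAt_add]
  | smul b x hx =>
    rw [map_smul, LinearMap.smul_apply, map_smul, map_smul, hx, ← algebraMap_smul L b,
      ← algebraMap_smul L b, transferAt_smul]
  | of C => rw [transferAt_comp_left, transferAt_toModRel]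

end Surface

namespace CobLoc

variable {k : Type} [CommRing k] (O : Cob) (x : Surface.ModRel k (O ⊕ O))

/-- The elements of the values of the tautological functor are linear combinations of cobordisms. -/
def tautologicalEquiv (S : Cob) :
    (fromCob k ⋙ tautological ((fromCob k).obj O) x).obj S ≃+ Surface.ModRel k (O ⊕ S) :=
  AddEquiv.refl _

theorem tautologicalEquiv_X_smul (S : Cob)
    (y : (fromCob k ⋙ tautological ((fromCob k).obj O) x).obj S) :
    tautologicalEquiv O x S ((Polynomial.X : Polynomial k) • y)
      = Surface.compModRel k O O S x (tautologicalEquiv O x S y) := by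
  -- The scalar action goes through the opposite of the endomorphism ring, so that precomposition is
  -- a left action.
  change (Polynomial.aeval (R := k)
    (MulOpposite.op (show End ((fromCob k).obj O) from x)) Polynomial.X).unop ≫
    (tautologicalEquiv O x S y : (fromCob k).obj O ⟶ (fromCob k).obj S) = _
  rw [Polynomial.aeval_X]
  rfl

theorem tautologicalEquiv_C_smul (S : Cob) (a : k)
    (y : (fromCob k ⋙ tautological ((fromCob k).obj O) x).obj S) :
    tautologicalEquiv O x S (Polynomial.C a • y) = a • tautologicalEquiv O x S y := by
  have h : ∀ z : (fromCob k).obj O ⟶ (fromCob k).obj S,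
      (a • 𝟙 ((fromCob k).obj O)) ≫ z = a • z := by
    intro z
    rw [Linear.smul_comp, Category.id_comp]
  refine Eq.trans ?_ (h (tautologicalEquiv O x S y))
  change (Polynomial.aeval (R := k)
    (MulOpposite.op (show End ((fromCob k).obj O) from x)) (Polynomial.C a)).unop ≫
    (tautologicalEquiv O x S y : (fromCob k).obj O ⟶ (fromCob k).obj S) = _
  rw [Polynomial.aeval_C]
  rfl

variable {L : Type} [Field L] [Algebra k L] [Algebra (Polynomial k) L]
  [IsScalarTower k (Polynomial k) L] {h t : Polynomial k} (s : Splitting L h t)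
  (v : (O → Bool) → L)

/-- The state sums of linear combinations of cobordisms, as a linear map over the polynomials in
the given operator. -/
def stateSumMap (hv : Surface.transferAt s k v x = algebraMap (Polynomial k) L Polynomial.X • v)
    (S : Cob) :
    (fromCob k ⋙ tautological ((fromCob k).obj O) x).obj S →ₗ[Polynomial k] ((S → Bool) → L) where
  toFun y := Surface.transferAt s k v (tautologicalEquiv O x S y)
  map_add' y z := by rw [map_add, map_add]
  map_smul' p y := by
    rw [RingHom.id_apply]
    induction p using Polynomial.induction_on' generalizing y with
    | add p q hp hq => rw [add_smul, add_smul, map_add, map_add, hp, hq]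
    | monomial n a =>
      rw [← Polynomial.C_mul_X_pow_eq_monomial]
      induction n generalizing y with
      | zero =>
        rw [pow_zero, mul_one, tautologicalEquiv_C_smul, map_smul,
          ← algebraMap_smul (Polynomial k) a]
        rfl
      -- Precomposition with the operator moves it onto `v`, where the eigenvector equation `hv`
      -- turns it into the variable.
      | succ n ih =>
        rw [pow_succ, ← mul_assoc, mul_smul, ih, tautologicalEquiv_X_smul,
          Surface.transferAt_compModRel, hv, Surface.transferAt_smul, algebraMap_smul,
          ← mul_smul]

variable [Nontrivial k]

/-- The tautological functor is a topological quantum field theory as soon as the linear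
combinations of cobordisms are generated by elements with the state sums of a basis. -/
theorem exists_tqft (hinj : Function.Injective (algebraMap (Polynomial k) L))
    (hv : Surface.transferAt s k v x = algebraMap (Polynomial k) L Polynomial.X • v)
    (e : ∀ S : Cob, (S → Fin 2) → Surface.ModRel k (O ⊕ S))
    (he : ∀ (S : Cob) (κ : S → Fin 2), Surface.transferAt s k v (e S κ)
      = s.evalTensor S (PiTensorProduct.tprod _ fun b => RankTwo.basis h t (κ b)))
    (hspan : ∀ (S : Cob) (W : Submodule k (Surface.ModRel k (O ⊕ S))),
      (∀ y ∈ W, Surface.compModRel k O O S x y ∈ W) → (∀ κ, e S κ ∈ W) →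
      ∀ C : Surface (O ⊕ S), Surface.toModRel k C ∈ W) :
    ∃ F : TQFT (RankTwo.frobenius h t),
      Nonempty (fromCob k ⋙ tautological ((fromCob k).obj O) x ≅ F.functor) := by
  let N (S : Cob) := (fromCob k ⋙ tautological ((fromCob k).obj O) x).obj S
  let Ψ := stateSumMap O x s v hv
  let e' (S : Cob) (κ : S → Fin 2) : N S := (tautologicalEquiv O x S).symm (e S κ)
  let A (S : Cob) := Basis.piTensorProduct (fun _ : S => RankTwo.basis h t)
  have hΨe (S : Cob) (κ : S → Fin 2) : Ψ S (e' S κ) = s.evalTensor S (A S κ) := by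
    rw [Basis.piTensorProduct_apply, ← he]
    exact congrArg _ ((tautologicalEquiv O x S).apply_symm_apply _)
  -- The images are an evaluated basis of the tensor power, independent because evaluation is
  -- injective.
  have hli (S : Cob) : LinearIndependent (Polynomial k) (e' S) := by
    refine LinearIndependent.of_comp (Ψ S) ?_
    have h1 : Ψ S ∘ e' S = s.evalTensor S ∘ A S := funext (hΨe S)
    rw [h1]
    exact (A S).linearIndependent.map' _ (LinearMap.ker_eq_bot.2 (s.evalTensor_injective hinj S))
  have hsp (S : Cob) : ⊤ ≤ Submodule.span (Polynomial k) (Set.range (e' S)) := by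
    -- The `k[X]`-span is viewed as a `k`-submodule stable under `x`, the form in which `hspan`
    -- applies.
    let W : Submodule k (Surface.ModRel k (O ⊕ S)) :=
      { carrier := {y | (tautologicalEquiv O x S).symm y
          ∈ Submodule.span (Polynomial k) (Set.range (e' S))}
        zero_mem' := by simp
        add_mem' := fun {a b} ha hb => by
          rw [Set.mem_ofPred_eq, map_add]
          exact Submodule.add_mem _ ha hb
        smul_mem' := fun a y hy => by
          have := tautologicalEquiv_C_smul O x S a ((tautologicalEquiv O x S).symm y)
          rw [AddEquiv.apply_symm_apply] at this
          rw [Set.mem_ofPred_eq, ← this, AddEquiv.symm_apply_apply]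
          exact Submodule.smul_mem _ _ hy }
    have hW : ∀ y ∈ W, Surface.compModRel k O O S x y ∈ W := by
      intro y hy
      have := tautologicalEquiv_X_smul O x S ((tautologicalEquiv O x S).symm y)
      rw [AddEquiv.apply_symm_apply] at this
      change (tautologicalEquiv O x S).symm (Surface.compModRel k O O S x y)
        ∈ Submodule.span (Polynomial k) (Set.range (e' S))
      rw [← this, AddEquiv.symm_apply_apply]
      have hy' : (tautologicalEquiv O x S).symm y
        ∈ Submodule.span (Polynomial k) (Set.range (e' S)) := hy
      exact Submodule.smul_mem _ _ hy'
    have hall := hspan S W hW fun κ => show (tautologicalEquiv O x S).symm (e S κ)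
        ∈ Submodule.span (Polynomial k) (Set.range (e' S)) from Submodule.subset_span ⟨κ, rfl⟩
    have hall' : ∀ y, y ∈ W := by
      intro y
      induction y using Surface.modRel_induction with
      | zero => exact W.zero_mem
      | add y z hy hz => exact W.add_mem hy hz
      | smul a y hy => exact W.smul_mem a hy
      | of C => exact hall C
    intro y _
    exact hall' (tautologicalEquiv O x S y)
  let Bs (S : Cob) := Module.Basis.mk (hli S) (hsp S)
  let E (S : Cob) : N S ≃ₗ[Polynomial k] ⨂[Polynomial k] _ : S, RankTwo.Alg h t :=
    (Bs S).equiv (A S) (Equiv.refl _)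
  have hE (S : Cob) (y : N S) : s.evalTensor S (E S y) = Ψ S y := by
    have : s.evalTensor S ∘ₗ (E S).toLinearMap = Ψ S := by
      refine (Bs S).ext fun κ => ?_
      rw [LinearMap.comp_apply, LinearEquiv.coe_coe, Module.Basis.equiv_apply,
        Module.Basis.mk_apply, hΨe]
      rfl
    exact LinearMap.congr_fun this y
  -- The TQFT structure is put on the tautological functor itself, so the natural isomorphism is the
  -- identity.
  refine ⟨s.tqft hinj _ E fun S T C y => ?_, ⟨Iso.refl _⟩⟩
  rw [hE]
  have h1 : s.evalTensor S y = Ψ S ((E S).symm y) := by rw [← hE, LinearEquiv.apply_symm_apply]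
  rw [h1]
  exact Surface.transferAt_comp s v (tautologicalEquiv O x S ((E S).symm y)) C

end CobLoc

/-! ### The circle over the integers -/

namespace Surface

/-- Precomposition with a handle adds a handle to the component of the source circle. -/
theorem comp_connected_one {S K : Type} [Finite K] (g : K → ℕ) (p : Unit ⊕ S → K) :
    comp (connected (Unit ⊕ Unit) 1) (of g p) = addTube g p (p (Sum.inl ())) (p (Sum.inl ())) := by
  classical
  have := Fintype.ofFinite K
  rw [connected, comp_of, addTube_self]
  symm
  refine of_eq_tubes (Sum.elim (fun _ => p (Sum.inl ())) id) (fun k => Quot.mk _ (Sum.inr k))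
    (fun k => ⟨Sum.inr k, rfl⟩) (fun _ => rfl) ?_ ?_ fun φ => ?_
  · rintro (u | k)
    · exact (Quot.sound ⟨(), rfl, rfl⟩ :
        Quot.mk _ (Sum.inl u) = Quot.mk _ (Sum.inr (p (Sum.inl ())))).symm
    · rfl
  · rintro (b | b) <;> rfl
  · simp only [Fintype.sum_sum_type]
    simp [Pi.single_apply, add_sub_right_comm, mul_add, Finset.sum_add_distrib, add_comm]

theorem comp_connected_empty {S K : Type} [Finite K] (n : ℕ) (g : K → ℕ) (p : Empty ⊕ S → K) :
    comp (connected (Empty ⊕ Empty) n) (of g p) = addClosed g p n := by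
  rw [connected, comp_of, tubes_of_isEmpty]
  refine of_eq_of (Equiv.sumComm _ _) ?_ ?_
  · rintro (u | k) <;> rfl
  · rintro (b | b)
    · exact b.elim
    · rfl

end Surface

/-- The splitting of `X² - H X` over the rational functions. -/
def splittingH : Splitting (FractionRing (Polynomial ℤ)) (Polynomial.X : Polynomial ℤ) 0 :=
  Splitting.ofRoots (algebraMap (Polynomial ℤ) _ Polynomial.X) 0
    (by simp) (by simp) (by simp)

theorem splittingH_root (b : Bool) :
    splittingH.root b = if b then algebraMap _ _ (Polynomial.X : Polynomial ℤ) else 0 := by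
  rfl

theorem splittingH_diff_true :
    (splittingH.diff true : FractionRing (Polynomial ℤ))
      = algebraMap _ _ (Polynomial.X : Polynomial ℤ) := by
  rw [Splitting.diff_eq]; simp [splittingH_root]

theorem Splitting.eval_basis {R L : Type} [CommRing R] [Nontrivial R] [Field L] [Algebra R L]
    {h t : R} (s : Splitting L h t) (b : Bool) (i : Fin 2) :
    s.eval b (RankTwo.basis h t i) = if i = 1 then s.root b else 1 := by
  fin_cases i <;> simp

/-- The surface of genus `0` over `S` in which the special circle and the circles in `κ⁻¹(1)` lie
on one component and all the other circles bound discs. -/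
def Surface.star {S : Type} [Finite S] (κ : S → Fin 2) : Surface (Unit ⊕ S) :=
  Surface.tubes (fun _ => 0) id (fun i : {b // κ b = 1} => Sum.inr i.1) fun _ => Sum.inl ()

/-- The vector is supported on the root `H`, as the other root is `0`. The special component
therefore has colour `true`, and its factor `H` cancels its weight `H⁻¹`. A circle with `κ b = 1` is
forced to the colour `true` and contributes `H` through its tube. The weights of the discs cancel
the target weights. -/
theorem transfer_star {S : Type} [Finite S] (κ : S → Fin 2) :
    Surface.transfer splittingH (Surface.star κ) (fun σ => splittingH.root (σ ()))
      = splittingH.evalTensor S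
          (PiTensorProduct.tprod _ fun b => RankTwo.basis Polynomial.X 0 (κ b)) := by
  classical
  have := Fintype.ofFinite S
  have hX : algebraMap (Polynomial ℤ) (FractionRing (Polynomial ℤ)) Polynomial.X ≠ 0 := by
    simp
  funext τ
  rw [Surface.transfer_apply, ← (Equiv.funUnique Unit Bool).symm.sum_comp, Fintype.sum_bool,
    Splitting.evalTensor_tprod]
  have h1 : ∀ b, splittingH.root ((Equiv.funUnique Unit Bool).symm b ()) = splittingH.root b :=
    fun _ => rfl
  have h2 : (Equiv.funUnique Unit Bool).symm true = fun _ => true := rfl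
  simp only [h1, splittingH_root, Splitting.eval_basis, Surface.star, Surface.stateSum_tubes]
  -- Each disc bounds exactly one circle, so the boundary colours determine the colouring.
  rw [Finset.sum_eq_single (Sum.elim (fun _ => true) τ)]
  · simp only [Function.comp_id, h2, true_and, funext_iff, Function.comp, Sum.elim_inl,
      Sum.elim_inr, if_true, Bool.false_eq_true, if_false, zero_mul, add_zero]
    by_cases h : ∀ i : {b // κ b = 1}, τ i.1 = true
    · rw [if_pos h]
      have h3 : ∀ i : {b // κ b = 1}, splittingH.diff (τ i.1) = splittingH.diff true := by
        intro i; rw [h i]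
      simp only [h3, Fintype.prod_sum_type, Units.val_mul]
      have h4 : ∀ b, (if κ b = 1 then
          if τ b = true then algebraMap (Polynomial ℤ) (FractionRing (Polynomial ℤ)) Polynomial.X
            else 0 else 1) = if κ b = 1 then
              algebraMap (Polynomial ℤ) (FractionRing (Polynomial ℤ)) Polynomial.X else 1 := by
        intro b
        by_cases hb : κ b = 1
        · rw [if_pos hb, if_pos hb, if_pos (h ⟨b, hb⟩)]
        · rw [if_neg hb, if_neg hb]
      simp only [h4]
      rw [Finset.prod_ite]
      simp [splittingH_diff_true, Fintype.card_subtype]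
      have hP : (∏ i, (splittingH.diff (τ i) : FractionRing (Polynomial ℤ))) ≠ 0 :=
        Finset.prod_ne_zero_iff.2 fun i _ => Units.ne_zero _
      field_simp
    · rw [if_neg h]
      push Not at h
      obtain ⟨i, hi⟩ := h
      rw [mul_zero, zero_mul]
      refine (Finset.prod_eq_zero (Finset.mem_univ i.1) ?_).symm
      rw [if_pos i.2, if_neg hi]
  · intro c _ hc
    rw [if_neg]
    rintro ⟨h, _⟩
    exact hc h
  · simp

/-- The cylinder of genus one multiplies by `θ`, which is `H` at one root and `-H` at the other. The
vector vanishes at the second root, so it is an eigenvector for `H`. -/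
theorem transfer_handle :
    Surface.transfer splittingH (Surface.connected (Unit ⊕ Unit) 1)
        (fun σ => splittingH.root (σ ()))
      = algebraMap (Polynomial ℤ) (FractionRing (Polynomial ℤ)) Polynomial.X •
        fun σ => splittingH.root (σ ()) := by
  funext τ
  rw [Surface.transfer_connected, Fintype.sum_eq_single (τ ())]
  · rw [if_pos rfl, Pi.smul_apply]
    rcases τ () with _ | _
    · simp [splittingH_root]
    · simp [splittingH_diff_true, splittingH_root]
  · intro b hb
    rw [if_neg]
    rintro rfl
    exact hb rfl

theorem Surface.toModRel_mem_of_star {k S : Type} [CommRing k] [Finite S]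
    (W : Submodule k (Surface.ModRel k (Unit ⊕ S)))
    (hW : ∀ y ∈ W, Surface.compModRel k Unit Unit S
      (Surface.toModRel k (Surface.connected (Unit ⊕ Unit) 1)) y ∈ W)
    (hstar : ∀ κ : S → Fin 2, Surface.toModRel k (Surface.star κ) ∈ W)
    (C : Surface (Unit ⊕ S)) : Surface.toModRel k C ∈ W := by
  classical
  refine Surface.toModRel_mem_of_stars W (Sum.inl ())
    (Surface.compModRel k Unit Unit S (Surface.toModRel k (Surface.connected (Unit ⊕ Unit) 1)))
    ?_ hW ?_ C
  · intro K _ g p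
    rw [Surface.compModRel_toModRel, Surface.comp_connected_one]
  · intro F _ u hu hu0
    have hex : ∀ f, ∃ b : S, u f = Sum.inr b := by
      intro f
      rcases hf : u f with x | b
      · exact absurd hf (hu0 f)
      · exact ⟨b, rfl⟩
    choose w hw using hex
    have hwinj : Function.Injective w := fun f f' h => hu (by rw [hw, hw, h])
    -- The label `1` marks the circles whose discs are joined to the special component.
    let κ : S → Fin 2 := fun b => if b ∈ Set.range w then 1 else 0
    have hκ : ∀ b, κ b = 1 ↔ b ∈ Set.range w := by
      intro b
      simp only [κ]
      split_ifs with hb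
      · exact iff_of_true rfl hb
      · exact iff_of_false (by decide) hb
    let ε : F ≃ {b // κ b = 1} := (Equiv.ofInjective w hwinj).trans
      (Equiv.subtypeEquivRight fun b => (hκ b).symm)
    have h := hstar κ
    have hu' : u = (fun i : {b // κ b = 1} => Sum.inr i.1) ∘ ε := funext fun f => hw f
    rw [Surface.star, Surface.tubes_reindex ε.symm] at h
    rw [hu']
    exact h

theorem tautological_circle :
    ∃ F_H : TQFT (RankTwo.frobenius (Polynomial.X : Polynomial ℤ) 0),
      Nonempty (CobLoc.fromCob ℤ ⋙
        CobLoc.tautological ((CobLoc.fromCob ℤ).obj Cob.circle) (CobLoc.handle ℤ)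
          ≅ F_H.functor) :=
  CobLoc.exists_tqft Cob.circle
    (Surface.toModRel ℤ (Surface.connected (Unit ⊕ Unit) 1)) splittingH
    (fun σ => splittingH.root (σ ())) (IsFractionRing.injective _ _)
    ((Surface.transferAt_toModRel splittingH _ _).trans transfer_handle)
    (fun _ κ => Surface.toModRel ℤ (Surface.star κ))
    (fun _ κ => (Surface.transferAt_toModRel splittingH _ _).trans (transfer_star κ))
    fun _ W hW he C => Surface.toModRel_mem_of_star W hW he C

/-! ### The empty object over the rationals -/

theorem algebraMap_algebraicClosure_injective :
    Function.Injective
      (algebraMap (Polynomial ℚ) (AlgebraicClosure (FractionRing (Polynomial ℚ)))) := by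
  rw [IsScalarTower.algebraMap_eq (Polynomial ℚ) (FractionRing (Polynomial ℚ))]
  exact (algebraMap (FractionRing (Polynomial ℚ)) _).injective.comp
    (IsFractionRing.injective (Polynomial ℚ) (FractionRing (Polynomial ℚ)))

/-- A splitting of `X² - T` over the algebraic closure of the rational functions. -/
theorem exists_splittingT :
    ∃ s : Splitting (AlgebraicClosure (FractionRing (Polynomial ℚ))) 0
      (Polynomial.X : Polynomial ℚ), ∀ b, (s.diff b : AlgebraicClosure _) = 2 * s.root b := by
  -- The roots are `u` and `-u` for a square root `u` of `T`, with difference `2u`.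
  obtain ⟨u, hu⟩ := IsAlgClosed.exists_pow_nat_eq
    (algebraMap (Polynomial ℚ) (AlgebraicClosure (FractionRing (Polynomial ℚ))) Polynomial.X)
    (n := 2) (by norm_num)
  have hu0 : u ≠ 0 := by
    rintro rfl
    have h : algebraMap (Polynomial ℚ) (AlgebraicClosure (FractionRing (Polynomial ℚ)))
        Polynomial.X = 0 := by rw [← hu]; simp
    exact Polynomial.X_ne_zero ((map_eq_zero_iff _ algebraMap_algebraicClosure_injective).1 h)
  have : CharZero (AlgebraicClosure (FractionRing (Polynomial ℚ))) := inferInstance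
  refine ⟨Splitting.ofRoots u (-u) (fun h => hu0 (self_eq_neg.1 h)) (by simp)
    (by rw [← hu]; ring), fun b => ?_⟩
  rw [Splitting.diff_eq]
  cases b <;> simp [Splitting.ofRoots] <;> ring

section

variable {L : Type} [Field L] [Algebra (Polynomial ℚ) L] [Algebra ℚ L]
  (s : Splitting L 0 (Polynomial.X : Polynomial ℚ))

/-- The closed surface of genus `3` has state sum `∑ θ² = 4T + 4T = 8T`. This explains the factor
`1/4 * 1/2`. -/
theorem transferAt_renormTwoHandle (hs : ∀ b, (s.diff b : L) = 2 * s.root b) :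
    Surface.transferAt s ℚ (fun _ => 1) ((1 / 4 : ℚ) • (1 / 2 : ℚ) •
        Surface.toModRel ℚ (Surface.connected (Empty ⊕ Empty) 3))
      = algebraMap (Polynomial ℚ) L Polynomial.X • fun _ => 1 := by
  have : CharZero L := algebraRat.charZero L
  funext τ
  have hτ : ∀ b, τ = fun _ => b := fun _ => Subsingleton.elim _ _
  rw [map_smul, map_smul, Surface.transferAt_toModRel, Pi.smul_apply, Pi.smul_apply,
    Surface.transfer_connected]
  have h1 := s.root_mul_root true
  have h2 := s.root_mul_root false
  simp only [← hτ, if_true, Fintype.sum_bool, Fintype.card_empty]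
  norm_num [hs, Algebra.smul_def, mul_pow]
  simp only [map_zero, zero_mul, zero_add] at h1 h2
  linear_combination (1 / 2) * h1 + (1 / 2) * h2

/-- The union of the discs, with one handle on each disc whose label under `κ` is `1`, multiplied by
one half for each handle. -/
def halfHandleDiscs {S : Type} [Finite S] (κ : S → Fin 2) : Surface.ModRel ℚ (Empty ⊕ S) :=
  (1 / 2 : ℚ) ^ (∑ᶠ b, (κ b : ℕ)) •
    Surface.toModRel ℚ (Surface.of (Sum.elim Empty.elim fun b => (κ b : ℕ)) id)

/-- After the target weight, a disc contributes `1`, and a disc with one handle contributes `θ = 2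
root`. Half of the latter is the value of `X`. -/
theorem transferAt_halfHandleDiscs (hs : ∀ b, (s.diff b : L) = 2 * s.root b)
    {S : Type} [Finite S] (κ : S → Fin 2) :
    Surface.transferAt s ℚ (fun _ => 1) (halfHandleDiscs κ)
      = s.evalTensor S (PiTensorProduct.tprod _ fun b => RankTwo.basis 0 Polynomial.X (κ b)) := by
  classical
  have : CharZero L := algebraRat.charZero L
  have := Fintype.ofFinite S
  funext τ
  rw [halfHandleDiscs, map_smul, Surface.transferAt_toModRel, Pi.smul_apply,
    Surface.transfer_apply, Fintype.sum_unique, Surface.stateSum_of, Splitting.evalTensor_tprod,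
    Finset.sum_eq_single (Sum.elim Empty.elim τ), finsum_eq_sum_of_fintype]
  · rw [if_pos, one_mul, Fintype.prod_sum_type]
    · simp only [Finset.univ_eq_empty, Finset.prod_empty, one_mul, Sum.elim_inr]
      rw [← Units.val_mul, ← Finset.prod_mul_distrib, Algebra.smul_def, map_pow,
        ← Finset.prod_pow_eq_pow_sum, Units.coe_prod, ← Finset.prod_mul_distrib]
      refine Finset.prod_congr rfl fun b _ => ?_
      rw [Splitting.eval_basis]
      generalize κ b = i
      fin_cases i
      · simp
      · simp [hs]
    · funext b
      rcases b with b | b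
      · exact b.elim
      · rfl
  · intro c _ hc
    rw [if_neg]
    intro h
    refine hc (funext fun b => ?_)
    rcases b with b | b
    · exact b.elim
    · exact congrFun h (Sum.inr b)
  · simp

end

theorem toModRel_mem_of_halfHandleDiscs {S : Type} [Finite S]
    (W : Submodule ℚ (Surface.ModRel ℚ (Empty ⊕ S)))
    (hW : ∀ y ∈ W, Surface.compModRel ℚ Empty Empty S ((1 / 4 : ℚ) • (1 / 2 : ℚ) •
      Surface.toModRel ℚ (Surface.connected (Empty ⊕ Empty) 3)) y ∈ W)
    (hdisc : ∀ κ : S → Fin 2, halfHandleDiscs κ ∈ W)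
    (C : Surface (Empty ⊕ S)) : Surface.toModRel ℚ C ∈ W := by
  have : Invertible (2 : ℚ) := invertibleOfNonzero two_ne_zero
  refine Surface.toModRel_mem_of_discs W
    (Surface.compModRel ℚ Empty Empty S (Surface.toModRel ℚ (Surface.connected (Empty ⊕ Empty) 3)))
    ?_ ?_ ?_ C
  · intro K _ g p
    rw [Surface.compModRel_toModRel, Surface.comp_connected_empty]
  · intro y hy
    -- The factor `8` undoes `1/4 * 1/2`.
    have h := W.smul_mem 8 (hW y hy)
    rw [map_smul, map_smul, LinearMap.smul_apply, LinearMap.smul_apply, smul_smul, smul_smul] at h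
    norm_num at h
    exact h
  · intro g hg
    -- Genera at most `1` are themselves labels in `Fin 2`; the power of `2` below removes the
    -- halves from `halfHandleDiscs`.
    let κ : S → Fin 2 := fun b => ⟨g (Sum.inr b), Nat.lt_succ_of_le (hg _)⟩
    have h := W.smul_mem (2 ^ (∑ᶠ b, (κ b : ℕ))) (hdisc κ)
    rw [halfHandleDiscs, smul_smul, ← mul_pow] at h
    norm_num at h
    have hg' : (Sum.elim Empty.elim fun b => (κ b : ℕ)) = g := by
      funext b
      rcases b with b | b
      · exact b.elim
      · rfl
    rwa [hg'] at h

theorem tautological_empty :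
    ∃ F_T : TQFT (RankTwo.frobenius 0 (Polynomial.X : Polynomial ℚ)),
      Nonempty (CobLoc.fromCob ℚ ⋙
        CobLoc.tautological ((CobLoc.fromCob ℚ).obj Cob.empty) CobLoc.renormTwoHandle
          ≅ F_T.functor) := by
  obtain ⟨s, hs⟩ := exists_splittingT
  exact CobLoc.exists_tqft Cob.empty
    ((1 / 4 : ℚ) • (1 / 2 : ℚ) • Surface.toModRel ℚ (Surface.connected (Empty ⊕ Empty) 3))
    s (fun _ => 1) algebraMap_algebraicClosure_injective (transferAt_renormTwoHandle s hs)
    (fun _ κ => halfHandleDiscs κ) (fun _ κ => transferAt_halfHandleDiscs s hs κ)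
    fun _ W hW he C => toModRel_mem_of_halfHandleDiscs W hW he C

end

theorem mainTheorem11 :
    (∃ F_H : TQFT (RankTwo.frobenius (Polynomial.X : Polynomial ℤ) 0),
      Nonempty (CobLoc.fromCob ℤ ⋙
        CobLoc.tautological ((CobLoc.fromCob ℤ).obj Cob.circle) (CobLoc.handle ℤ) ≅ F_H.functor)) ∧
    (∃ F_T : TQFT (RankTwo.frobenius 0 (Polynomial.X : Polynomial ℚ)),
      Nonempty (CobLoc.fromCob ℚ ⋙
        CobLoc.tautological ((CobLoc.fromCob ℚ).obj Cob.empty) CobLoc.renormTwoHandle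
            ≅ F_T.functor)) := by
  exact ⟨tautological_circle, tautological_empty⟩
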